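/- Throughout, all numbers are natural numbers, and $f^{i}$ with $i\in\mathbb N$ is the $i$-fold iterate of $f:\mathbb N\to\mathbb N$. **Ordinal iteration.** Let $0<\alpha<\epsilon_0$ have Cantor normal form with last term $\omega^{\gamma}c$ ($c\ge 1$), say $\alpha=\alpha'+\omega^\gamma c$. For $x\in\mathbb N$ put $\alpha[x]=\alpha'+(c-1)$ if $\gamma=0$, and $\alpha[x]=\alpha'+\omega^{\gamma}(c-1)+\omega^{\gamma[x]}x$ if $\gamma>0$. For $g:\mathbb N\to\mathbb N$ define $g^{0}(b)=b$ and $g^{\alpha}(b)=g^{\alpha[b]}(g(b))$ for $\alpha>0$. Let $\mathcal G(b)=b+1$. **Auxiliary functions.** Put $\mathfrak d_n(b)=(2b)^{2^n}$, $\mathfrak g(b,d)=d(1+b)^d$, and $$\mathfrak e(n,b)=2^{(b+\mathfrak d_{n-1}(b))^{n-1}+1}b+b+\mathfrak d_{n-1}(b),$$ $$\zeta_0(n,d)=\binom{n+\mathfrak d_n(d)}{n},\quad \zeta_1(n,d,b)=\Bigl(\binom{b+n}{n}+2\Bigr)\zeta_0(n,d),\quad \zeta_2(n,d,b)=(\zeta_1(n,d,b)+1)^{2^{\zeta_1(n,d,b)}-1}.$$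 Put $\mathfrak p_1(d)=d$ and, for $n\ge 2$, with $\upsilon=\zeta_1(n-1,\mathfrak p_{n-1}(d),d)\,\zeta_2(n-1,\mathfrak p_{n-1}(d),d)$, $$\mathfrak p_n(d)=\max\Bigl\{2\binom{\upsilon+n}{n}\upsilon,\ \mathfrak e(n-1,d)\Bigr\}.$$ For a function $D:\mathbb N\to\mathbb N$ and a finite multiset $\tau$ of natural numbers, $\mathfrak m_{\emptyset,D}(i)=0$ and, for $\tau\ne\emptyset$ with least element $k$, $\mathfrak m_{\tau,D}(i)=1+\mathfrak m_{\tau',D}(i+1)$, where $\tau'$ arises from $\tau$ by removing one copy of $k$ and, if $k>0$, adding $k(D(i)-1)$ copies of $k-1$. Put $\mathfrak m^*(D,n)=\mathfrak m_{\{n\},D+1}(0)+1$. For $F:\mathbb N\to\mathbb N$ let $F_x(b)=F(\mathfrak p_x(b))$ and $$\mathfrak u_F(x)=F_x^{\,\mathfrak m^*(i\mapsto F_x^{i}(x),\,x)}(x),\qquad \mathfrak u_F^+(b)=\max\Bigl\{\mathfrak u_F(b),\ \mathfrak d_{b+1}\Bigl(2b\binom{2b}{b}+1\Bigr)\Bigr\},$$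 and, with $U=\mathfrak u^+_F(b)$ and $N=\mathfrak d_U(U)+U$, $$\mathfrak f(F,b)=\mathfrak d_U\Bigl(\binom{N+b}{b}U\Bigr)+N.$$ Put $\mathfrak z^0(d,b)=d$ and, with $\mathfrak g^*=\mathfrak g(b+d-1,\max\{b+d-1,2b\})$, $$\mathfrak z^{k+1}(d,b)=\mathfrak z^{k}\Bigl(\mathfrak d_{b+d}\Bigl((\mathfrak g^*+d+1)\binom{2b}{b}2b+d\Bigr)+\mathfrak g^*+d+1,\ b\Bigr).$$ **Bad leader sequences.** Fix $m$ derivations $\delta_1,\dots,\delta_m$ and $n$ differential indeterminates $X_1,\dots,X_n$. Derivatives $\delta_1^{k_1}\cdots\delta_m^{k_m}X_r$ are ordered first by order $\sum_i k_i$, then lexicographically by $(k_1,\dots,k_m)$, then by $r$; they are identified with their positions $1,2,3,\dots$ in this ordering. A bad leader sequence is a finite sequence $\gamma=\langle u_1,\dots,u_k\rangle$ of derivatives with $u_1<\dots<u_k$ such that for $i<j$ there is no $\theta=\delta_1^{\theta_1}\cdots\delta_m^{\theta_m}$ with $\theta u_i=u_j$. For $D:\mathbb N\to\mathbb N$ and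 a bad leader sequence $\gamma$, the number $\mathfrak h_{n,m}(D,\gamma)$ is defined by recursion on the (well-founded) tree of bad leader sequences. If $\gamma$ is maximal, it is $1$. Otherwise put $w_{D(1)}=1$ and, for $u=D(1),D(1)-1,\dots,0$: if $\gamma^\frown\langle u\rangle$ is not a bad leader sequence, $w_{u-1}=w_u$; if it is, put $v_{u,D(w_u)}=w_u$, $v_{u,k-1}=v_{u,k}+\mathfrak h_{n,m}\bigl(i\mapsto D(v_{u,k}+i),\ \gamma^\frown\langle u\rangle\bigr)$ for $k=D(w_u),\dots,1$, and $w_{u-1}=v_{u,0}$. Then $\mathfrak h_{n,m}(D,\gamma)=w_{-1}$. Put $\mathfrak h_{n,m}(D)=\mathfrak h_{n,m}(D,\langle\rangle)$. **The characteristic set bound.** Let $F^{\mathrm{char}}_c(k)=\mathfrak z^{k+1}(k,\mathfrak g(c,k))$. Put $D^{\mathrm{char}}_{b,n,m}(0)=b$ and, with $c=D^{\mathrm{char}}_{b,n,m}(i)$, $$D^{\mathrm{char}}_{b,n,m}(i+1)=\max\Bigl\{\mathfrak g\Bigl(c,\binom{2c+m-1}{m-1}\,n\,(c+1)\Bigr),\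 \mathfrak p_{c}\bigl(\mathfrak u_{F^{\mathrm{char}}_{c}}(c)\bigr),\ \mathfrak f(F^{\mathrm{char}}_{c},c)\Bigr\}.$$ Set $\mathfrak i^{\mathrm{char}}_{n,m}(b)=D^{\mathrm{char}}_{b,n,m}\bigl(\mathfrak h_{n,m}(D^{\mathrm{char}}_{b,n,m})\bigr)$. **Lemma.** Let $m\ge 1$ and $b\ge\max\{m,n\}$. Then $$\mathfrak i^{\mathrm{char}}_{n,m}(b)\ \le\ \mathcal G^{\,\omega^{\omega^m\cdot 2n+\omega}+\omega^{\omega^m\cdot 2n+5}+\omega^{\omega+1}\cdot 5+\omega^{\omega}\cdot 2+\omega^2\cdot 5+\omega\cdot 10}(b).$$ -/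

import Mathlib

open scoped Ordinal

noncomputable section

namespace CharBound

/-! ### Iteration of a function along an ordinal below `ε₀` -/

/-- The ordinal `ω ^ e * n + t` in Cantor normal form; nothing is written when `n = 0`. -/
def addTerm (e : ONote) (n : ℕ) (t : ONote) : ONote :=
  match n with
  | 0 => t
  | k + 1 => ONote.oadd e k.succPNat t

/-- `α[x]`, computed on the Cantor normal form. If the last term is `ω ^ e * n`, it is replaced by
`ω ^ e * (n - 1) + ω ^ (e[x]) * x` when `e ≠ 0`, and by `n - 1` when `e = 0`; `0[x] = 0`. -/
def stepNote : ONote → ℕ → ONote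
  | ONote.zero, _ => 0
  | ONote.oadd e n ONote.zero, x =>
      addTerm e n.natPred (if e = 0 then 0 else addTerm (stepNote e x) x 0)
  | ONote.oadd e n (ONote.oadd e' n' t'), x => ONote.oadd e n (stepNote (ONote.oadd e' n' t') x)

theorem addTerm_nfBelow {e t : ONote} {b : Ordinal} (he : e.NF) (ht : ONote.NFBelow t e.repr)
    (hb : e.repr < b) (n : ℕ) : ONote.NFBelow (addTerm e n t) b := by
  cases n with
  | zero => exact ht.mono hb.le
  | succ k => exact ONote.NFBelow.oadd he ht hb

theorem nfBelow_zero_note (b : Ordinal) : ONote.NFBelow 0 b := ONote.NFBelow.zero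

theorem addTerm_nf {e t : ONote} (he : e.NF) (ht : ONote.NFBelow t e.repr) (n : ℕ) :
    (addTerm e n t).NF :=
  ⟨⟨_, addTerm_nfBelow he ht (Order.lt_succ e.repr) n⟩⟩

theorem stepNote_spec : ∀ (o : ONote), o.NF → o ≠ 0 → ∀ x : ℕ,
    stepNote o x < o ∧ (stepNote o x).NF
  | ONote.zero, _, h, _ => absurd rfl h
  | ONote.oadd e n ONote.zero, hnf, _, x => by
      have he : e.NF := hnf.fst
      set t : ONote := if e = 0 then 0 else addTerm (stepNote e x) x 0 with htdef
      have ht : ONote.NFBelow t e.repr := by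
        by_cases h0 : e = 0
        · rw [htdef, if_pos h0]; exact nfBelow_zero_note _
        · rw [htdef, if_neg h0]
          obtain ⟨h1, h2⟩ := stepNote_spec e he h0 x
          exact addTerm_nfBelow h2 (nfBelow_zero_note _) h1 x
      have hlt : t.repr < ω ^ e.repr := ht.repr_lt
      have hstep : stepNote (ONote.oadd e n ONote.zero) x = addTerm e n.natPred t := by
        rw [stepNote]
      rw [hstep]
      refine ⟨?_, addTerm_nf he ht _⟩
      rw [ONote.lt_def]
      cases hk : n.natPred with
      | zero =>
        exact hlt.trans_le (ONote.omega0_le_oadd e n _)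
      | succ k =>
        have hn : ((n : ℕ) : Ordinal.{0}) = (k : Ordinal) + 1 + 1 := by
          have h' : (n : ℕ) = k + 1 + 1 := by
            have := PNat.natPred_add_one n
            omega
          rw [h']; push_cast; rfl
        simp only [addTerm, ONote.repr, Nat.succPNat_coe, Nat.succ_eq_add_one, Nat.cast_add,
          Nat.cast_one, hn]
        rw [mul_add (ω ^ e.repr) ((k : Ordinal) + 1) 1, mul_one]
        simpa using hlt
  | ONote.oadd e n (ONote.oadd e' n' t'), hnf, _, x => by
      obtain ⟨h1, h2⟩ := stepNote_spec (ONote.oadd e' n' t') hnf.snd (by intro h; cases h) x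
      rw [stepNote]
      refine ⟨ONote.oadd_lt_oadd_3 h1, ?_⟩
      refine ONote.NF.oadd hnf.fst n (ONote.NF.below_of_lt' ?_ h2)
      exact lt_trans h1 hnf.snd'.repr_lt

/-- `g^α(b)` for `α` in Cantor normal form: `g^0(b) = b` and `g^α(b) = g^{α[b]}(g(b))`. -/
def iterNote (g : ℕ → ℕ) (α : NONote) (b : ℕ) : ℕ :=
  if h : α.1 = 0 then b
  else iterNote g ⟨stepNote α.1 b, (stepNote_spec α.1 α.2 h b).2⟩ (g b)
termination_by α
decreasing_by exact (stepNote_spec α.1 α.2 h b).1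

open Classical in
/-- `g^α(b)` for an ordinal `α < ε₀`, through its Cantor normal form. The value is the junk `0` for
ordinals without such a notation, that is, for `α ≥ ε₀`. -/
def ordIter (g : ℕ → ℕ) (α : Ordinal.{0}) (b : ℕ) : ℕ :=
  if h : ∃ o : NONote, o.repr = α then iterNote g h.choose b else 0

theorem ordIter_repr (g : ℕ → ℕ) (o : NONote) (b : ℕ) : ordIter g o.repr b = iterNote g o b := by
  have h : ∃ o' : NONote, o'.repr = o.repr := ⟨o, rfl⟩
  have h' : h.choose = o := Subtype.ext (ONote.repr_inj.1 h.choose_spec)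
  rw [ordIter, dif_pos h, h']

/-! ### Bounds for polynomial rings -/

/-- `𝔡_n(b) = (2b)^(2^n)` -/
def dB (n b : ℕ) : ℕ := (2 * b) ^ 2 ^ n

/-- `𝔢(n, b)`; used for `n ≥ 1` only -/
def eB (n b : ℕ) : ℕ :=
  2 ^ ((b + dB (n - 1) b) ^ (n - 1) + 1) * b + b + dB (n - 1) b

def zeta0 (n d : ℕ) : ℕ := (n + dB n d).choose n

def zeta1 (n d b : ℕ) : ℕ := ((b + n).choose n + 2) * zeta0 n d

def zeta2 (n d b : ℕ) : ℕ := (zeta1 n d b + 1) ^ (2 ^ zeta1 n d b - 1)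

/-- `υ(n, d)` as a function of the value `q = 𝔭_{n-1}(d)` -/
def upsilon (n q d : ℕ) : ℕ := zeta1 (n - 1) q d * zeta2 (n - 1) q d

/-- `𝔭_n(d)`; used for `n ≥ 1` only -/
def pB : ℕ → ℕ → ℕ
  | 0, d => d
  | 1, d => d
  | n + 2, d =>
      max (2 * (upsilon (n + 2) (pB (n + 1) d) d + (n + 2)).choose (n + 2) *
            upsilon (n + 2) (pB (n + 1) d) d)
        (eB (n + 1) d)

/-- The multiset `τ_{⟨k,i,D⟩}`: one copy of `k` is removed, and `k * (D i - 1)` copies of `k - 1`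
are added (none if `k = 0`). -/
def replaceOne (D : ℕ → ℕ) (τ : Multiset ℕ) (k i : ℕ) : Multiset ℕ :=
  τ.erase k + Multiset.replicate (k * (D i - 1)) (k - 1)

theorem min_mem {τ : Multiset ℕ} (h : τ ≠ 0) : sInf {k | k ∈ τ} ∈ τ :=
  Nat.sInf_mem (s := {k | k ∈ τ}) (Multiset.exists_mem_of_ne_zero h)

theorem replaceOne_lt (D : ℕ → ℕ) {τ : Multiset ℕ} {k : ℕ} (hk : k ∈ τ) (i : ℕ) :
    Multiset.IsDershowitzMannaLT (replaceOne D τ k i) τ := by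
  refine ⟨τ.erase k, Multiset.replicate (k * (D i - 1)) (k - 1), {k}, by simp, rfl, ?_, ?_⟩
  · rw [add_comm, Multiset.singleton_add, Multiset.cons_erase hk]
  · intro y hy
    obtain ⟨h0, rfl⟩ := Multiset.mem_replicate.1 hy
    refine ⟨k, by simp, ?_⟩
    have : k ≠ 0 := by rintro rfl; simp at h0
    omega

/-- `𝔪_{τ,D}(i)` -/
def mB (D : ℕ → ℕ) (τ : Multiset ℕ) (i : ℕ) : ℕ :=
  if h : τ = 0 then 0
  else 1 + mB D (replaceOne D τ (sInf {k | k ∈ τ}) i) (i + 1)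
termination_by τ
decreasing_by exact replaceOne_lt D (min_mem h) i

/-- `𝔪*(D, n)` -/
def mStar (D : ℕ → ℕ) (n : ℕ) : ℕ := mB (fun i => D i + 1) {n} 0 + 1

/-! ### Bounds for differential polynomial rings -/

/-- `𝔤(b, d) = d (1 + b)^d` -/
def gB (b d : ℕ) : ℕ := d * (1 + b) ^ d

/-- `F_x(b) = F(𝔭_x(b))` -/
def subF (F : ℕ → ℕ) (x b : ℕ) : ℕ := F (pB x b)

/-- `𝔲_F(x)` -/
def uB (F : ℕ → ℕ) (x : ℕ) : ℕ :=
  (subF F x)^[mStar (fun i => (subF F x)^[i] x) x] x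

/-- `𝔲⁺_F(b)` -/
def uPlus (F : ℕ → ℕ) (b : ℕ) : ℕ :=
  max (uB F b) (dB (b + 1) (2 * b * (2 * b).choose b + 1))

/-- the number `N` in the definition of `𝔣(F, b)` -/
def fN (F : ℕ → ℕ) (b : ℕ) : ℕ := dB (uPlus F b) (uPlus F b) + uPlus F b

/-- `𝔣(F, b)` -/
def fB (F : ℕ → ℕ) (b : ℕ) : ℕ :=
  dB (uPlus F b) ((fN F b + b).choose b * uPlus F b) + fN F b

/-- `𝔷^k(d, b)`. The truncated difference `b + d - 1` differs from the integer one only for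
`b = d = 0`, where both give `𝔤(b + d - 1, max (b + d - 1) (2 * b)) = 0`. -/
def zB : ℕ → ℕ → ℕ → ℕ
  | 0, d, _ => d
  | k + 1, d, b =>
      zB k
        (dB (b + d) ((gB (b + d - 1) (max (b + d - 1) (2 * b)) + d + 1) *
              (2 * b).choose b * (2 * b) + d) +
          gB (b + d - 1) (max (b + d - 1) (2 * b)) + d + 1)
        b

/-! ### Derivatives, their ranking, and bad leader sequences -/

/-- The derivative `δ₁^{k₁} ⋯ δ_m^{k_m} X_r` (with `m` derivations and `n` indeterminates). -/
@[ext]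
structure Derivative (m n : ℕ) where
  exp : Fin m → ℕ
  var : Fin n

variable {m n : ℕ}

/-- The derivative `θ u`, where `θ = δ₁^{θ₁} ⋯ δ_m^{θ_m}`. -/
def Derivative.apply (θ : Fin m → ℕ) (u : Derivative m n) : Derivative m n :=
  ⟨θ + u.exp, u.var⟩

def Derivative.order (u : Derivative m n) : ℕ := ∑ i, u.exp i

/-- The orderly ranking: first by order, then lexicographically by exponents, then by the
indeterminate. -/
def Derivative.Lower (u v : Derivative m n) : Prop :=
  u.order < v.order ∨
    (u.order = v.order ∧
      (toLex u.exp < toLex v.exp ∨ (u.exp = v.exp ∧ u.var < v.var)))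

/-- The position of `u` in the ranking; the lowest derivative has position `1`. -/
def Derivative.index (u : Derivative m n) : ℕ := {w : Derivative m n | w.Lower u}.ncard + 1

theorem Derivative.Lower.irrefl (u : Derivative m n) : ¬ u.Lower u := by
  rintro (h | ⟨-, h | ⟨-, h⟩⟩)
  · exact lt_irrefl _ h
  · exact lt_irrefl _ h
  · exact lt_irrefl _ h

theorem Derivative.Lower.trans {u v w : Derivative m n} (h1 : u.Lower v) (h2 : v.Lower w) :
    u.Lower w := by
  rcases h1 with h1 | ⟨h1, h1'⟩ <;> rcases h2 with h2 | ⟨h2, h2'⟩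
  · exact Or.inl (h1.trans h2)
  · exact Or.inl (h2 ▸ h1)
  · exact Or.inl (h1 ▸ h2)
  · refine Or.inr ⟨h1.trans h2, ?_⟩
    rcases h1' with h1' | ⟨h1', h1''⟩ <;> rcases h2' with h2' | ⟨h2', h2''⟩
    · exact Or.inl (h1'.trans h2')
    · exact Or.inl (h2' ▸ h1')
    · exact Or.inl (h1' ▸ h2')
    · exact Or.inr ⟨h1'.trans h2', h1''.trans h2''⟩

theorem Derivative.Lower.total (u v : Derivative m n) : u.Lower v ∨ u = v ∨ v.Lower u := by
  rcases lt_trichotomy u.order v.order with h | h | h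
  · exact Or.inl (Or.inl h)
  · rcases lt_trichotomy (toLex u.exp) (toLex v.exp) with h' | h' | h'
    · exact Or.inl (Or.inr ⟨h, Or.inl h'⟩)
    · have h'' : u.exp = v.exp := toLex.injective h'
      rcases lt_trichotomy u.var v.var with h3 | h3 | h3
      · exact Or.inl (Or.inr ⟨h, Or.inr ⟨h'', h3⟩⟩)
      · exact Or.inr (Or.inl (Derivative.ext h'' h3))
      · exact Or.inr (Or.inr (Or.inr ⟨h.symm, Or.inr ⟨h''.symm, h3⟩⟩))
    · exact Or.inr (Or.inr (Or.inr ⟨h.symm, Or.inl h'⟩))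
  · exact Or.inr (Or.inr (Or.inl h))

theorem Derivative.finite_lower (u : Derivative m n) :
    {w : Derivative m n | w.Lower u}.Finite := by
  let f : Derivative m n → (Fin m → ℕ) × Fin n := fun w => (w.exp, w.var)
  have hf : Function.Injective f := by
    intro a b h
    exact Derivative.ext (congrArg Prod.fst h) (congrArg Prod.snd h)
  refine Set.Finite.of_finite_image (f := f) ?_ hf.injOn
  refine Set.Finite.subset
    ((Set.finite_Iic (fun _ : Fin m => u.order)).prod (Set.finite_univ (α := Fin n))) ?_
  rintro _ ⟨w, hw, rfl⟩
  refine ⟨?_, trivial⟩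
  have hle : w.order ≤ u.order := by
    rcases hw with h | ⟨h, -⟩
    · exact h.le
    · exact h.le
  intro i
  exact (Finset.single_le_sum (f := w.exp) (fun _ _ => Nat.zero_le _)
    (Finset.mem_univ i)).trans hle

theorem Derivative.index_lt_index {u v : Derivative m n} (h : u.Lower v) :
    u.index < v.index := by
  refine Nat.add_lt_add_right (Set.ncard_lt_ncard ?_ v.finite_lower) 1
  exact (Set.ssubset_iff_of_subset fun w hw => Derivative.Lower.trans hw h).2
    ⟨u, h, Derivative.Lower.irrefl u⟩

theorem Derivative.index_injective :
    Function.Injective (Derivative.index : Derivative m n → ℕ) := by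
  intro u v h
  rcases Derivative.Lower.total u v with h' | h' | h'
  · exact absurd h (Derivative.index_lt_index h').ne
  · exact h'
  · exact absurd h (Derivative.index_lt_index h').ne'

/-- A bad leader sequence `⟨u₁, …, u_k⟩`: increasing in the ranking, and no `u_j` is of the form
`θ u_i` with `i < j`. Lists are written with the last element first, `[u_k, …, u₁]`. -/
def IsBad (γ : List (Derivative m n)) : Prop :=
  γ.Pairwise fun v u => u.Lower v ∧ ¬ ∃ θ : Fin m → ℕ, u.apply θ = v

/-- The bad leader sequences (in the above reversed notation). -/
def BadSeq (m n : ℕ) : Type := {γ : List (Derivative m n) // IsBad γ}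

/-- `δ` extends `γ` by one element. -/
def BadSeq.Extends (δ γ : BadSeq m n) : Prop := ∃ u, δ.1 = u :: γ.1

theorem Derivative.wqo :
    WellQuasiOrdered fun u v : Derivative m n => ∃ θ : Fin m → ℕ, u.apply θ = v := by
  have h1 : WellQuasiOrdered fun a b : Fin m → ℕ => a ≤ b := wellQuasiOrdered_le
  have h2 : WellQuasiOrdered fun a b : Fin n => a = b := Finite.wellQuasiOrdered _
  intro f
  obtain ⟨i, j, hij, h, h'⟩ := h1.prod h2 fun k => ((f k).exp, (f k).var)
  refine ⟨i, j, hij, (f j).exp - (f i).exp, Derivative.ext ?_ h'⟩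
  exact tsub_add_cancel_of_le h

theorem BadSeq.extends_wf : WellFounded (BadSeq.Extends : BadSeq m n → BadSeq m n → Prop) := by
  refine ⟨fun a => ?_⟩
  by_contra ha
  obtain ⟨f, -, hstep⟩ := not_acc_iff_exists_descending_chain.1 ha
  choose u hu using hstep
  have hmem : ∀ i j, i < j → u i ∈ (f j).1 := by
    intro i j hij
    induction j with
    | zero => omega
    | succ j ih =>
      rw [hu j]
      rcases Nat.lt_succ_iff_lt_or_eq.1 hij with h | rfl
      · exact List.mem_cons_of_mem _ (ih h)
      · exact List.mem_cons_self
  obtain ⟨i, j, hij, hθ⟩ := Derivative.wqo u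
  have hbad : IsBad (u j :: (f j).1) := hu j ▸ (f (j + 1)).2
  exact ((List.pairwise_cons.1 hbad).1 _ (hmem i j hij)).2 hθ

instance : WellFoundedRelation (BadSeq m n) := ⟨BadSeq.Extends, BadSeq.extends_wf⟩

def BadSeq.nil (m n : ℕ) : BadSeq m n := ⟨[], List.Pairwise.nil⟩

open Classical in
/-- `𝔥_{n,m}(D, γ)`, which depends on `γ` only through its bad leader sequence `γ_μ`.

The fold runs through `u = D 1, D 1 - 1, …, 0` and computes the numbers `w_u`: it starts from
`w_{D 1} = 1`, sends `w_u` to `w_{u-1}`, and returns `w_{-1}`. When `u` is the position of a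
derivative that extends `γ` to a bad leader sequence, the number `v_{u,k}` is obtained from
`v_{u,D(w_u)} = w_u` by `D(w_u) - k` steps `v ↦ v + 𝔥(D_v, γ⌢⟨u⟩)`, where `D_v(i) = D(v + i)`, and
`w_{u-1} = v_{u,0}`. When `γ` is maximal, no `u` contributes and the value is `1`. -/
def hB (D : ℕ → ℕ) (γ : BadSeq m n) : ℕ :=
  (List.range (D 1 + 1)).foldr
    (fun u w =>
      if h : ∃ v : Derivative m n, v.index = u ∧ IsBad (v :: γ.1) then
        (fun t => t + hB (fun i => D (t + i)) ⟨h.choose :: γ.1, h.choose_spec.2⟩)^[D w] w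
      else w)
    1
termination_by γ
decreasing_by exact ⟨_, rfl⟩

/-! ### The characteristic set bound -/

/-- `F^char_c(k)` -/
def FChar (c k : ℕ) : ℕ := zB (k + 1) k (gB c k)

/-- `D^char_{b,n,m}(i)` -/
def DChar (n m b : ℕ) : ℕ → ℕ
  | 0 => b
  | i + 1 =>
      max (gB (DChar n m b i)
            ((2 * DChar n m b i + m - 1).choose (m - 1) * n * (DChar n m b i + 1)))
        (max (pB (DChar n m b i) (uB (FChar (DChar n m b i)) (DChar n m b i)))
          (fB (FChar (DChar n m b i)) (DChar n m b i)))

/-- `𝔦^char_{n,m}(b)` -/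
def iChar (n m b : ℕ) : ℕ := DChar n m b (hB (DChar n m b) (BadSeq.nil m n))

/-- `𝒢(b) = b + 1` -/
def G (b : ℕ) : ℕ := b + 1

end CharBound

end

/-! For `G` the successor, `iterNote G α` is a Hardy function, and `fast e`, its member at `ω ^ e`,
is a fast-growing hierarchy: for `e ≠ 0`, `fast e x` applies `fast e[x]` to `x + 1`, `x` times. Each
loop in a definition therefore costs about one level. Comparing levels needs control of the
coefficients: if `β < α` and `coeffNorm β < x`, then `β ≤ α[x]` (`le_stepNote`). This yields
monotonicity in ordinal and argument (`iterNote_mono`), and lets `fast e'` absorb up to `z`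
iterations of `fast e` at `z` when `e < e'` (`fast_iterate_le_fast`).

Elementary expressions lie below level 3, `𝔭` below 4, `F^char` below 5 and `F_x` below 6. The
descent from the multiset `{k}` is a `k`-fold nested loop and reaches level `2k + 8`; with `k` an
argument this is level `ω`. One step of `D^char` is then bounded at level `ω + 1` (`DChar_succ_le`).

For the tree, well-foundedness is made quantitative. The derivatives that can still extend `γ` are
covered by finitely many cylinders. Appending `u` replaces a cylinder containing `u` by at most
`u.order` cylinders of smaller dimension (`Covers.cons`), so the sum of `ω ^ dim` over the cover
drops. Induction on the tree (`hB_le`) bounds `D (hB D γ)`, the value rather than the index, at this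
ordinal slightly enlarged to pay for the two nested loops in `𝔥`. The initial cover has rank `ω ^ m
* n`, and for `n ≥ 1` the enlarged one is below `ω ^ m * 2n + ω`. The other terms of the theorem's
ordinal only make the argument large enough for the side conditions. -/

noncomputable section

namespace CharBound

/-! ### Norms of ordinal notations -/

/-- The largest coefficient that occurs hereditarily in a notation. -/
def coeffNorm : ONote → ℕ
  | ONote.zero => 0
  | ONote.oadd e n a => max (coeffNorm e) (max (n : ℕ) (coeffNorm a))

theorem coeffNorm_zero : coeffNorm 0 = 0 := rfl

theorem coeffNorm_oadd (e : ONote) (n : ℕ+) (a : ONote) :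
    coeffNorm (ONote.oadd e n a) = max (coeffNorm e) (max (n : ℕ) (coeffNorm a)) := rfl

theorem coeffNorm_ofNat (k : ℕ) : coeffNorm (ONote.ofNat k) = k := by
  cases k with
  | zero => rfl
  | succ k => simp [coeffNorm_oadd, coeffNorm_zero]

theorem coeffNorm_addTerm_le (e : ONote) (n : ℕ) (t : ONote) :
    coeffNorm (addTerm e n t) ≤ max (coeffNorm e) (max n (coeffNorm t)) := by
  cases n with
  | zero => simp [addTerm]
  | succ k => simp [addTerm, coeffNorm_oadd]

theorem coeffNorm_stepNote_le : ∀ (o : ONote) (x : ℕ),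
    coeffNorm (stepNote o x) ≤ max (coeffNorm o) x
  | ONote.zero, x => by rw [stepNote]; simp [coeffNorm_zero]
  | ONote.oadd e n ONote.zero, x => by
      have ih := coeffNorm_stepNote_le e x
      have hn : n.natPred ≤ n := by have := PNat.natPred_add_one n; omega
      have h1 := coeffNorm_addTerm_le e n.natPred (if e = 0 then 0 else addTerm (stepNote e x) x 0)
      have h2 : coeffNorm (if e = 0 then 0 else addTerm (stepNote e x) x 0) ≤
          max (coeffNorm e) x := by
        split_ifs
        · simp [coeffNorm_zero]
        · have := coeffNorm_addTerm_le (stepNote e x) x 0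
          rw [coeffNorm_zero] at this
          omega
      rw [stepNote, coeffNorm_oadd]
      omega
  | ONote.oadd e n (ONote.oadd e' n' t'), x => by
      have ih := coeffNorm_stepNote_le (ONote.oadd e' n' t') x
      rw [stepNote, coeffNorm_oadd, coeffNorm_oadd e n]
      omega

theorem note_lt_trichotomy (a b : ONote) [a.NF] [b.NF] : a < b ∨ a = b ∨ b < a := by
  rcases lt_trichotomy a.repr b.repr with h | h | h
  · exact Or.inl h
  · exact Or.inr (Or.inl (ONote.repr_inj.1 h))
  · exact Or.inr (Or.inr h)

theorem addTerm_succ (e : ONote) (k : ℕ) (t : ONote) :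
    addTerm e (k + 1) t = ONote.oadd e k.succPNat t := rfl

theorem lt_addTerm_of_lt {a e t : ONote} (n : ℕ) (ha : ONote.NFBelow a e.repr) (h : a ≤ t) :
    a ≤ addTerm e n t := by
  cases n with
  | zero => exact h
  | succ k => exact (ha.repr_lt.trans_le (ONote.omega0_le_oadd e _ _)).le

/-- The bound that makes fundamental sequences cofinal in a norm-controlled way. -/
theorem le_stepNote : ∀ (α : ONote), α.NF → ∀ β : ONote, β.NF → ∀ x : ℕ, β < α →
    coeffNorm β < x → β ≤ stepNote α x
  | ONote.zero, _, β, _, x, h, _ => by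
      exact absurd h (not_lt_of_ge (by rw [ONote.le_def]; exact bot_le))
  | ONote.oadd e n ONote.zero, hα, β, hβ, x, h, hx => by
      have he : e.NF := hα.fst
      -- The leading exponent of `a` is at most `e[x]` by induction. If it equals `e[x]`, the
      -- leading coefficient is below `x`, which is where strictness of the norm bound is needed.
      have key : ∀ a : ONote, ONote.NFBelow a e.repr → coeffNorm a < x →
          a ≤ (if e = 0 then 0 else addTerm (stepNote e x) x 0) := by
        intro a ha hax
        cases a with
        | zero => rw [ONote.le_def]; exact bot_le
        | oadd e₂ n₂ a₂ =>
          have hlt : e₂ < e := ha.lt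
          have he₂ : e₂.NF := ha.fst
          have hne : e ≠ 0 := by
            rintro rfl
            exact absurd hlt (not_lt_of_ge (by rw [ONote.le_def]; exact bot_le))
          rw [if_neg hne]
          rw [coeffNorm_oadd] at hax
          have ih := le_stepNote e he e₂ he₂ x hlt (by omega)
          have hsn : (stepNote e x).NF := (stepNote_spec e he hne x).2
          obtain ⟨y, rfl⟩ : ∃ y, x = y + 1 := ⟨x - 1, by omega⟩
          rw [addTerm_succ]
          rcases note_lt_trichotomy e₂ (stepNote e (y + 1)) with h1 | h1 | h1
          · exact (ONote.oadd_lt_oadd_1 ⟨⟨_, ha⟩⟩ h1).le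
          · rw [← h1]
            refine (ONote.oadd_lt_oadd_2 ⟨⟨_, ha⟩⟩ ?_).le
            rw [Nat.succPNat_coe]; omega
          · exact absurd h1 (not_lt_of_ge ih)
      rw [stepNote]
      set t : ONote := if e = 0 then 0 else addTerm (stepNote e x) x 0 with ht
      cases β with
      | zero => rw [ONote.le_def]; exact bot_le
      | oadd e' n' a' =>
        have he' : e'.NF := hβ.fst
        rcases note_lt_trichotomy e' e with h1 | h1 | h1
        · have hb : ONote.NFBelow (ONote.oadd e' n' a') e.repr := ONote.NF.below_of_lt h1 hβ
          exact lt_addTerm_of_lt _ hb (key _ hb hx)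
        · subst h1
          have hn : n' < n := by
            by_contra hcon
            rcases (not_lt.1 hcon).lt_or_eq with h2 | h2
            · exact lt_asymm h (ONote.oadd_lt_oadd_2 hα h2)
            · subst h2
              exact absurd h (not_lt_of_ge (by
                rw [ONote.le_def]
                simp only [ONote.repr]
                exact add_le_add le_rfl bot_le))
          have hpred := PNat.natPred_add_one n
          have hn2 : (n' : ℕ) < n := hn
          have hpos := n'.pos
          obtain ⟨k, hk⟩ : ∃ k, n.natPred = k + 1 := ⟨n.natPred - 1, by omega⟩
          rw [hk, addTerm_succ]
          rcases lt_or_eq_of_le (show (n' : ℕ) ≤ k + 1 by omega) with h2 | h2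
          · exact (ONote.oadd_lt_oadd_2 hβ (by rw [Nat.succPNat_coe]; omega)).le
          · have : n' = k.succPNat := PNat.eq (by rw [Nat.succPNat_coe]; omega)
            rw [this, ONote.le_def]
            simp only [ONote.repr]
            rw [coeffNorm_oadd] at hx
            have hk : a'.repr ≤ t.repr := key a' hβ.snd' (by omega)
            gcongr
        · exact absurd (ONote.oadd_lt_oadd_1 hα h1) (lt_asymm h)
  | ONote.oadd e n (ONote.oadd e₁ n₁ t₁), hα, β, hβ, x, h, hx => by
      have he : e.NF := hα.fst
      have ih := le_stepNote (ONote.oadd e₁ n₁ t₁) hα.snd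
      rw [stepNote]
      cases β with
      | zero => rw [ONote.le_def]; exact bot_le
      | oadd e' n' a' =>
        have he' : e'.NF := hβ.fst
        rcases note_lt_trichotomy e' e with h1 | h1 | h1
        · exact (ONote.oadd_lt_oadd_1 hβ h1).le
        · subst h1
          rcases lt_trichotomy (n' : ℕ) n with h2 | h2 | h2
          · exact (ONote.oadd_lt_oadd_2 hβ h2).le
          · obtain rfl := PNat.eq h2
            have hlt : a' < ONote.oadd e₁ n₁ t₁ := by
              rw [ONote.lt_def] at h ⊢
              simp only [ONote.repr] at h ⊢
              exact lt_of_add_lt_add_left h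
            rw [coeffNorm_oadd] at hx
            have := ih a' hβ.snd x hlt (by omega)
            rw [ONote.le_def]
            simp only [ONote.repr]
            have hk : a'.repr ≤ _ := this
            gcongr
          · exact absurd (ONote.oadd_lt_oadd_2 hα h2) (lt_asymm h)
        · exact absurd (ONote.oadd_lt_oadd_1 hα h1) (lt_asymm h)

theorem below_zero (e : NONote) : NONote.below 0 e := ONote.NFBelow.zero

/-! ### The Hardy functions -/

theorem iterNote_of_eq (g : ℕ → ℕ) (α : NONote) (h : α.1 = 0) (x : ℕ) : iterNote g α x = x := by
  rw [iterNote, dif_pos h]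

theorem iterNote_zero (g : ℕ → ℕ) (h : (0 : ONote).NF) (x : ℕ) : iterNote g ⟨0, h⟩ x = x :=
  iterNote_of_eq g _ rfl x

theorem iterNote_of_ne (g : ℕ → ℕ) (α : NONote) (h : α.1 ≠ 0) (x : ℕ) :
    iterNote g α x = iterNote g ⟨stepNote α.1 x, (stepNote_spec α.1 α.2 h x).2⟩ (g x) := by
  rw [iterNote, dif_neg h]

theorem iterNote_eq_of_step (g : ℕ → ℕ) {α β : NONote} (h : α.1 ≠ 0) {x : ℕ}
    (hβ : β.1 = stepNote α.1 x) : iterNote g α x = iterNote g β (g x) := by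
  rw [iterNote_of_ne g α h]
  congr 1
  exact Subtype.ext hβ.symm

/-- Follow the descent of the larger ordinal: it cannot jump below `β` while the norm of `β` is less
than the argument. -/
theorem iterNote_mono (α : NONote) : ∀ (β : NONote) (x y : ℕ), β ≤ α → coeffNorm β.1 < x → x ≤ y →
    iterNote G β x ≤ iterNote G α y := by
  induction α using WellFoundedLT.induction with
  | ind α ih =>
    intro β x y hle hx hxy
    by_cases hα : α.1 = 0
    · have hβ : β.1 = 0 := by
        have : β.1.repr ≤ α.1.repr := hle
        have := β.2
        have := α.2
        apply ONote.repr_inj.1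
        rw [hα] at *
        exact le_antisymm ‹_› bot_le
      obtain ⟨α, hα'⟩ := α
      obtain ⟨β, hβ'⟩ := β
      subst hα hβ
      rwa [iterNote_zero, iterNote_zero]
    · have hstep := stepNote_spec α.1 α.2 hα y
      rw [iterNote_of_ne G α hα]
      set α' : NONote := ⟨stepNote α.1 y, hstep.2⟩
      have hα' : α' < α := hstep.1
      -- If `β < α`, only `α` takes a step; if they are equal, both do, and the norm of `β[x]` stays
      -- below the new argument `x + 1`.
      rcases hle.lt_or_eq with h | rfl
      · exact ih α' hα' β x (G y) (le_stepNote α.1 α.2 β.1 β.2 y h (hx.trans_le hxy)) hx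
          (hxy.trans (Nat.le_succ y))
      · rw [iterNote_of_ne G β hα]
        have hn := coeffNorm_stepNote_le β.1 x
        refine ih α' hα' _ _ _ ?_ (show _ < x + 1 by simp only; omega) (Nat.succ_le_succ hxy)
        rcases hxy.lt_or_eq with h | rfl
        · exact le_stepNote β.1 β.2 _ (stepNote_spec β.1 β.2 hα x).2 y
            (stepNote_spec β.1 β.2 hα x).1 (by omega)
        · exact le_rfl

theorem self_le_iterNote (α : NONote) : ∀ x : ℕ, x ≤ iterNote G α x := by
  induction α using WellFoundedLT.induction with
  | ind α ih =>
    intro x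
    by_cases hα : α.1 = 0
    · rw [iterNote, dif_pos hα]
    · rw [iterNote_of_ne G α hα]
      exact (Nat.le_succ x).trans (ih _ (stepNote_spec α.1 α.2 hα x).1 (G x))

/-- Steps act on the last term only, so the tail `t` is used up before `ω ^ e * n` is touched. -/
theorem iterNote_oadd (g : ℕ → ℕ) (e : NONote) (n : ℕ+) (t : NONote) :
    ∀ (h : NONote.below t e) (x : ℕ), iterNote g (NONote.oadd e n t h) x =
      iterNote g (NONote.oadd e n 0 (below_zero e)) (iterNote g t x) := by
  induction t using WellFoundedLT.induction with
  | ind t ih =>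
    intro h x
    by_cases ht : t.1 = 0
    · obtain ⟨t, ht'⟩ := t
      subst ht
      rw [iterNote_zero]
      rfl
    · rw [iterNote_of_ne g t ht]
      have hs := stepNote_spec t.1 t.2 ht x
      have hb : NONote.below ⟨stepNote t.1 x, hs.2⟩ e :=
        ONote.NF.below_of_lt' (lt_trans hs.1 (ONote.NFBelow.repr_lt h)) hs.2
      rw [← ih ⟨stepNote t.1 x, hs.2⟩ hs.1 hb]
      refine iterNote_eq_of_step g (by intro h; cases h) ?_
      obtain ⟨t, ht'⟩ := t
      cases t with
      | zero => exact absurd rfl ht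
      | oadd e' n' t' =>
        change ONote.oadd e.1 n (stepNote (ONote.oadd e' n' t') x) =
          stepNote (ONote.oadd e.1 n (ONote.oadd e' n' t')) x
        rw [stepNote]

/-- The function `𝒢^(ω^e)`. -/
def fast (e : NONote) (x : ℕ) : ℕ := iterNote G (NONote.oadd e 1 0 (below_zero e)) x

theorem fast_zero (x : ℕ) : fast 0 x = x + 1 := by
  rw [fast, iterNote_eq_of_step G (β := 0) (by intro h; cases h)]
  · exact iterNote_of_eq G 0 rfl _
  · change 0 = stepNote (ONote.oadd 0 1 ONote.zero) x
    rw [stepNote, if_pos rfl]; rfl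

theorem iterNote_oadd_zero (e : NONote) (n : ℕ) (x : ℕ) :
    iterNote G (NONote.oadd e n.succPNat 0 (below_zero e)) x = (fast e)^[n + 1] x := by
  induction n generalizing x with
  | zero => rfl
  | succ n ih =>
    have hs := stepNote_spec (ONote.oadd e.1 1 ONote.zero)
      (NONote.oadd e 1 0 (below_zero e)).2 (by intro h; cases h) x
    have hlt : NONote.below ⟨stepNote (ONote.oadd e.1 1 ONote.zero) x, hs.2⟩ e := by
      refine ONote.NF.below_of_lt' ?_ hs.2
      have := hs.1
      rw [ONote.lt_def] at this
      simpa [ONote.repr] using! this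
    rw [Function.iterate_succ_apply, ← ih, fast,
      iterNote_eq_of_step G (α := NONote.oadd e 1 0 _) (by intro h; cases h)
        (β := ⟨stepNote (ONote.oadd e.1 1 ONote.zero) x, hs.2⟩) rfl,
      ← iterNote_oadd G e n.succPNat _ hlt]
    refine iterNote_eq_of_step G (by intro h; cases h) ?_
    change ONote.oadd e.1 n.succPNat (stepNote (ONote.oadd e.1 1 ONote.zero) x) =
      stepNote (ONote.oadd e.1 (n + 1).succPNat ONote.zero) x
    rw [stepNote, stepNote]
    rfl

theorem iterNote_oadd_fast (e : NONote) (n : ℕ) (t : NONote) (h : NONote.below t e) (x : ℕ) :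
    iterNote G (NONote.oadd e n.succPNat t h) x = (fast e)^[n + 1] (iterNote G t x) := by
  rw [iterNote_oadd, iterNote_oadd_zero]

theorem fast_of_ne {e : NONote} (h : e.1 ≠ 0) (x : ℕ) :
    fast e x = (fast ⟨stepNote e.1 x, (stepNote_spec e.1 e.2 h x).2⟩)^[x] (x + 1) := by
  rw [fast]
  cases x with
  -- The new term has coefficient `0` and vanishes, so both sides are `1`.
  | zero =>
    rw [iterNote_eq_of_step G (β := 0) (by intro h; cases h)]
    · exact iterNote_of_eq G 0 rfl _
    · change 0 = stepNote (ONote.oadd e.1 1 ONote.zero) 0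
      rw [stepNote, if_neg h]; rfl
  | succ x =>
    refine Eq.trans ?_ (iterNote_oadd_zero _ x (x + 1 + 1))
    refine iterNote_eq_of_step G (by intro h; cases h) ?_
    change _ = stepNote (ONote.oadd e.1 1 ONote.zero) (x + 1)
    rw [stepNote, if_neg h]; rfl

theorem fast_mono {e e' : NONote} {x y : ℕ} (h : e ≤ e') (he : coeffNorm e.1 < x) (hx : 1 < x)
    (hxy : x ≤ y) : fast e x ≤ fast e' y := by
  refine iterNote_mono _ _ _ _ ?_ ?_ hxy
  · change ONote.repr _ ≤ ONote.repr _
    simp only [NONote.oadd, ONote.repr]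
    gcongr
    · exact Ordinal.omega0_pos
    · exact h
  · change coeffNorm (ONote.oadd e.1 1 0) < x
    rw [coeffNorm_oadd, coeffNorm_zero, PNat.one_coe]
    omega

theorem self_lt_fast (e : NONote) (x : ℕ) : x < fast e x := by
  refine lt_of_lt_of_eq ?_ (iterNote_of_ne G _ (by intro h; cases h) x).symm
  exact (Nat.lt_succ_self x).trans_le (self_le_iterNote _ _)

theorem self_le_iterate_of_le {f : ℕ → ℕ} (hf : ∀ x, x ≤ f x) (k x : ℕ) : x ≤ f^[k] x :=
  Function.id_le_iterate_of_id_le hf k x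

theorem self_le_fast_iterate (e : NONote) (k x : ℕ) : x ≤ (fast e)^[k] x :=
  self_le_iterate_of_le (fun x => (self_lt_fast e x).le) k x

theorem fast_iterate_le_iterate (e : NONote) {j k : ℕ} (h : j ≤ k) (x : ℕ) :
    (fast e)^[j] x ≤ (fast e)^[k] x := by
  obtain ⟨i, rfl⟩ := Nat.exists_eq_add_of_le' h
  rw [Function.iterate_add_apply]
  exact self_le_fast_iterate e i _

theorem fast_iterate_mono {e e' : NONote} (h : e ≤ e') (k : ℕ) {x y : ℕ} (he : coeffNorm e.1 < x)
    (hx : 1 < x) (hxy : x ≤ y) : (fast e)^[k] x ≤ (fast e')^[k] y := by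
  induction k generalizing x y with
  | zero => exact hxy
  | succ k ih =>
    rw [Function.iterate_succ_apply, Function.iterate_succ_apply]
    have := self_lt_fast e x
    exact ih (by omega) (by omega) (fast_mono h he hx hxy)

/-- Iterating `fast e` at most `z` times stays below `fast e'` for `e < e'`. -/
theorem fast_iterate_le_fast {e e' : NONote} {j z : ℕ} (h : e < e') (he : coeffNorm e.1 < z)
    (hz : 1 < z) (hj : j ≤ z) : (fast e)^[j] (z + 1) ≤ fast e' z := by
  have hne : e'.1 ≠ 0 := by
    intro h0
    have h1 : e.1.repr < e'.1.repr := h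
    rw [h0] at h1
    exact absurd h1 (not_lt_of_ge bot_le)
  rw [fast_of_ne hne]
  refine (fast_iterate_le_iterate e hj _).trans (fast_iterate_mono ?_ _ (by omega) (by omega) le_rfl)
  exact le_stepNote e'.1 e'.2 e.1 e.2 z h he

theorem fast_iterate_le_fast' {e e' : NONote} {j z : ℕ} (h : e < e') (he : coeffNorm e.1 < z)
    (hz : 1 < z) (hj : j ≤ z) : (fast e)^[j] z ≤ fast e' z :=
  (fast_iterate_mono le_rfl j he hz (Nat.le_succ z)).trans (fast_iterate_le_fast h he hz hj)

/-! ### The finite levels -/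

/-- The function `𝒢^(ω^k)` for a natural number `k`. -/
def fastNat (k : ℕ) : ℕ → ℕ := fast (NONote.ofNat k)

theorem coeffNorm_nonote_ofNat (k : ℕ) : coeffNorm (NONote.ofNat k).1 = k := coeffNorm_ofNat k

theorem repr_nonote_ofNat (k : ℕ) : (NONote.ofNat k).repr = k := ONote.repr_ofNat k

theorem nonote_ofNat_lt {j k : ℕ} (h : j < k) : NONote.ofNat j < NONote.ofNat k := by
  change (NONote.ofNat j).repr < (NONote.ofNat k).repr
  rw [repr_nonote_ofNat, repr_nonote_ofNat]
  exact_mod_cast h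

theorem nonote_ofNat_le {j k : ℕ} (h : j ≤ k) : NONote.ofNat j ≤ NONote.ofNat k := by
  change (NONote.ofNat j).repr ≤ (NONote.ofNat k).repr
  rw [repr_nonote_ofNat, repr_nonote_ofNat]
  exact_mod_cast h

theorem fastNat_mono {j k x y : ℕ} (h : j ≤ k) (hj : j < x) (hx : 1 < x) (hxy : x ≤ y) :
    fastNat j x ≤ fastNat k y :=
  fast_mono (nonote_ofNat_le h) (by rwa [coeffNorm_nonote_ofNat]) hx hxy

theorem self_lt_fastNat (k x : ℕ) : x < fastNat k x := self_lt_fast _ x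

theorem fastNat_iterate_le {i j k z : ℕ} (h : j < k) (hj : j < z) (hz : 1 < z) (hi : i ≤ z) :
    (fastNat j)^[i] z ≤ fastNat k z :=
  fast_iterate_le_fast' (nonote_ofNat_lt h) (by rwa [coeffNorm_nonote_ofNat]) hz hi

theorem fastNat_fastNat_le {j k z : ℕ} (h : j < k) (hj : j < z) (hz : 1 < z) :
    fastNat j (fastNat j z) ≤ fastNat k z :=
  fastNat_iterate_le (i := 2) h hj hz hz

theorem fastNat_zero (x : ℕ) : fastNat 0 x = x + 1 := fast_zero x

theorem fastNat_zero_iterate (i x : ℕ) : (fastNat 0)^[i] x = x + i := by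
  induction i generalizing x with
  | zero => rfl
  | succ i ih => rw [Function.iterate_succ_apply, ih, fastNat_zero]; omega

theorem le_fastNat_one {x : ℕ} (hx : 1 < x) : 2 * x + 1 ≤ fastNat 1 x := by
  have h : (fastNat 0)^[x] (x + 1) ≤ fastNat 1 x :=
    fast_iterate_le_fast (nonote_ofNat_lt one_pos) (by rw [coeffNorm_nonote_ofNat]; omega) hx le_rfl
  rw [fastNat_zero_iterate] at h
  omega

theorem le_fastNat_one_iterate (i : ℕ) {x : ℕ} (hx : 1 < x) : 2 ^ i * x ≤ (fastNat 1)^[i] x := by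
  induction i generalizing x with
  | zero => simp
  | succ i ih =>
    have h1 := le_fastNat_one hx
    have h2 := ih (x := fastNat 1 x) (by omega)
    rw [Function.iterate_succ_apply, pow_succ, mul_assoc]
    exact (Nat.mul_le_mul_left _ (by omega)).trans h2

theorem le_fastNat_two {x : ℕ} (hx : 1 < x) : 2 ^ x * (x + 1) ≤ fastNat 2 x := by
  have h : (fastNat 1)^[x] (x + 1) ≤ fastNat 2 x :=
    fast_iterate_le_fast (nonote_ofNat_lt one_lt_two) (by rwa [coeffNorm_nonote_ofNat]) hx le_rfl
  exact (le_fastNat_one_iterate x (by omega)).trans h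

/-! ### Elementary bounds -/

/-- `v` is at most the `j`-fold iterate of the exponential function `𝒢^(ω^2)` at `y`. -/
def ElemBound (y j v : ℕ) : Prop := v ≤ (fastNat 2)^[j] y

namespace ElemBound

variable {y i j v w : ℕ}

theorem mono (h : ElemBound y i v) (hij : i ≤ j) : ElemBound y j v :=
  le_trans h (fast_iterate_le_iterate _ hij y)

theorem of_le (h : v ≤ y) : ElemBound y j v := mono (i := 0) h (Nat.zero_le _)

theorem anti (h : ElemBound y j w) (hv : v ≤ w) : ElemBound y j v := le_trans hv h

/-- One further application of the exponential dominates sums, products and powers of two at once;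
the index `j` thus counts the nesting depth of an expression. -/
theorem exists_le (hy : 1 < y) (hv : ElemBound y j v) (hw : ElemBound y j w) :
    ∃ z, 1 < z ∧ v ≤ z ∧ w ≤ z ∧ ∀ u, u ≤ 2 ^ z * (z + 1) → ElemBound y (j + 1) u := by
  refine ⟨(fastNat 2)^[j] y, hy.trans_le (self_le_fast_iterate _ _ _), hv, hw, fun u hu => ?_⟩
  rw [ElemBound, Function.iterate_succ_apply']
  exact hu.trans (le_fastNat_two (hy.trans_le (self_le_fast_iterate _ _ _)))

theorem mul (hy : 1 < y) (hv : ElemBound y j v) (hw : ElemBound y j w) :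
    ElemBound y (j + 1) (v * w) := by
  obtain ⟨z, -, h1, h2, h⟩ := exists_le hy hv hw
  exact h _ (Nat.mul_le_mul (h1.trans Nat.lt_two_pow_self.le) (h2.trans (Nat.le_succ z)))

theorem add (hy : 1 < y) (hv : ElemBound y j v) (hw : ElemBound y j w) :
    ElemBound y (j + 1) (v + w) := by
  obtain ⟨z, hz, h1, h2, h⟩ := exists_le hy hv hw
  refine h _ ?_
  have : 2 * z ≤ 2 ^ z * (z + 1) :=
    Nat.mul_le_mul (by simpa using Nat.pow_le_pow_right two_pos hz.le) (Nat.le_succ z)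
  omega

theorem two_pow (hy : 1 < y) (hv : ElemBound y j v) : ElemBound y (j + 1) (2 ^ v) := by
  obtain ⟨z, -, h1, -, h⟩ := exists_le hy hv hv
  exact h _ ((Nat.pow_le_pow_right two_pos h1).trans (Nat.le_mul_of_pos_right _ z.succ_pos))

theorem pow (hy : 1 < y) (hv : ElemBound y j v) (hw : ElemBound y j w) :
    ElemBound y (j + 2) (v ^ w) := by
  refine (two_pow hy (mul hy hv hw)).anti ?_
  rw [pow_mul]
  exact Nat.pow_le_pow_left Nat.lt_two_pow_self.le w

theorem choose (hy : 1 < y) (hv : ElemBound y j v) (w : ℕ) : ElemBound y (j + 1) (v.choose w) :=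
  (two_pow hy hv).anti (Nat.choose_le_two_pow v w)

theorem max (hv : ElemBound y j v) (hw : ElemBound y j w) : ElemBound y j (max v w) :=
  max_le hv hw

/-- An expression of fixed depth is absorbed by level 3 once the argument exceeds its depth; this is
the reason for thresholds such as `20 ≤ y` below. -/
theorem le_fastNat_three (hv : ElemBound y j v) (hj : j ≤ y) (hy : 2 < y) : v ≤ fastNat 3 y :=
  le_trans hv (fastNat_iterate_le (by omega) hy (by omega) hj)

theorem dB (hy : 1 < y) (hv : ElemBound y j v) (hw : ElemBound y j w) :
    ElemBound y (j + 3) (dB v w) :=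
  pow hy (mul hy (of_le hy) hw) (two_pow hy hv)

theorem eB (hy : 1 < y) (hv : ElemBound y j v) (hw : ElemBound y j w) :
    ElemBound y (j + 11) (eB v w) := by
  have hv' : ElemBound y j (v - 1) := hv.anti (Nat.sub_le _ _)
  have hd := dB hy hv' hw
  have h1 : ElemBound y (j + 4) (w + CharBound.dB (v - 1) w) := add hy (hw.mono (by omega)) hd
  have h2 := two_pow hy (add hy (pow hy h1 (hv'.mono (by omega))) (of_le (v := 1) hy.le))
  exact add hy (add hy (mul hy h2 (hw.mono (by omega))) (hw.mono (by omega))) (hd.mono (by omega))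

theorem zeta0 (hy : 1 < y) (hv : ElemBound y j v) (hw : ElemBound y j w) :
    ElemBound y (j + 5) (zeta0 v w) :=
  choose hy (add hy (hv.mono (by omega)) (dB hy hv hw)) _

theorem zeta1 {u : ℕ} (hy : 1 < y) (hv : ElemBound y j v) (hw : ElemBound y j w)
    (hu : ElemBound y j u) : ElemBound y (j + 6) (zeta1 v w u) :=
  mul hy ((add hy (choose hy (add hy hu hv) _) (of_le hy)).mono (by omega)) (zeta0 hy hv hw)

theorem zeta2 {u : ℕ} (hy : 1 < y) (hv : ElemBound y j v) (hw : ElemBound y j w)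
    (hu : ElemBound y j u) : ElemBound y (j + 9) (zeta2 v w u) :=
  pow hy (add hy (zeta1 hy hv hw hu) (of_le hy.le))
    ((two_pow hy (zeta1 hy hv hw hu)).anti (Nat.sub_le _ _))

theorem upsilon {u : ℕ} (hy : 1 < y) (hv : ElemBound y j v) (hw : ElemBound y j w)
    (hu : ElemBound y j u) : ElemBound y (j + 10) (upsilon v w u) := by
  have hv' : ElemBound y j (v - 1) := hv.anti (Nat.sub_le _ _)
  exact mul hy ((zeta1 hy hv' hw hu).mono (by omega)) (zeta2 hy hv' hw hu)

theorem gB (hy : 1 < y) (hv : ElemBound y j v) (hw : ElemBound y j w) :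
    ElemBound y (j + 4) (gB v w) :=
  mul hy (hw.mono (by omega)) (pow hy (add hy (of_le hy.le) hv) (hw.mono (by omega)))

end ElemBound

/-! ### Finite levels for `𝔭`, `𝔷`, `F^char` and `F_x`. -/

theorem pB_le {d y : ℕ} (hy : 20 ≤ y) (hd : d ≤ y) : ∀ n, n ≤ y → pB n d ≤ (fastNat 3)^[n] y
  | 0, _ => hd
  | 1, _ => hd.trans (self_le_fast_iterate _ _ _)
  | n + 2, hn => by
    have ih := pB_le hy hd (n + 1) (by omega)
    rw [Function.iterate_succ_apply']
    set z := (fastNat 3)^[n + 1] y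
    have hz : y ≤ z := self_le_fast_iterate _ _ _
    have hz1 : 1 < z := by omega
    have hn' : ElemBound z 0 (n + 2) := ElemBound.of_le (hn.trans hz)
    have hd' : ElemBound z 0 d := ElemBound.of_le (hd.trans hz)
    have hu := ElemBound.upsilon hz1 hn' (ElemBound.of_le ih) hd'
    -- Depth 14: ten for `υ`, then a sum, a binomial coefficient and two products; the `𝔢` branch
    -- needs only 11.
    refine ElemBound.le_fastNat_three (j := 14) ?_ (by omega) (by omega)
    rw [pB]
    refine ElemBound.max ?_ ?_
    · exact (ElemBound.mul hz1 (ElemBound.mul hz1 (ElemBound.of_le hz1)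
        (ElemBound.choose hz1 (ElemBound.add hz1 hu (hn'.mono (by omega))) _))
        (hu.mono (by omega))).mono (by omega)
    · exact (ElemBound.eB hz1 (ElemBound.of_le (by omega)) hd').mono (by omega)

theorem pB_le_fastNat_four {n d y : ℕ} (hy : 20 ≤ y) (hn : n ≤ y) (hd : d ≤ y) :
    pB n d ≤ fastNat 4 y :=
  (pB_le hy hd n hn).trans (fastNat_iterate_le (by omega) (by omega) (by omega) hn)

/-- The recursion transforms `d` before it descends in `k`, so `d` and its bound `z` vary in the
induction while `b` stays fixed. -/
theorem zB_le {b : ℕ} : ∀ (k : ℕ) {d z : ℕ}, 20 ≤ z → d ≤ z → b ≤ z →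
    zB k d b ≤ (fastNat 3)^[k] z
  | 0, _, _, _, hd, _ => hd
  | k + 1, d, z, hz, hd, hb => by
    have hlt := self_lt_fastNat 3 z
    rw [zB, Function.iterate_succ_apply]
    refine zB_le k (by omega) ?_ (by omega)
    have hz1 : 1 < z := by omega
    have hd' : ElemBound z 0 d := ElemBound.of_le hd
    have hb' : ElemBound z 0 b := ElemBound.of_le hb
    have hbd := ElemBound.add hz1 hb' hd'
    have h2b : ElemBound z 1 (2 * b) := ElemBound.mul hz1 (ElemBound.of_le hz1) hb'
    have hs : ElemBound z 1 (b + d - 1) := hbd.anti (Nat.sub_le _ _)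
    have hg := ElemBound.gB hz1 hs (hs.max h2b)
    have h1 : ElemBound z 0 1 := ElemBound.of_le hz1.le
    refine ElemBound.le_fastNat_three (j := 16) ?_ (by omega) (by omega)
    have hgd := ElemBound.add hz1 (ElemBound.add hz1 hg (hd'.mono (by omega)))
      (h1.mono (by omega))
    have hprod := ElemBound.mul hz1 (ElemBound.mul hz1 hgd
      ((ElemBound.choose hz1 h2b b).mono (by omega))) (h2b.mono (by omega))
    have hD := ElemBound.dB hz1 (hbd.mono (by omega))
      (ElemBound.add hz1 hprod (hd'.mono (by omega)))
    exact ElemBound.add hz1 (ElemBound.add hz1 (ElemBound.add hz1 hD (hg.mono (by omega)))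
      (hd'.mono (by omega))) (h1.mono (by omega))

theorem FChar_le {c k y : ℕ} (hy : 20 ≤ y) (hc : c ≤ y) (hk : k ≤ y) :
    FChar c k ≤ fastNat 5 y := by
  have hlt := self_lt_fastNat 3 y
  have hg : gB c k ≤ fastNat 3 y :=
    ElemBound.le_fastNat_three (ElemBound.gB (by omega) (ElemBound.of_le (j := 0) hc)
      (ElemBound.of_le hk)) (by omega) (by omega)
  calc FChar c k ≤ (fastNat 3)^[k + 1] (fastNat 3 y) :=
        zB_le (k + 1) (by omega) (by omega) hg
    _ ≤ fastNat 4 (fastNat 3 y) :=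
        fastNat_iterate_le (by omega) (by omega) (by omega) (by omega)
    _ ≤ fastNat 4 (fastNat 4 y) :=
        fastNat_mono le_rfl (by omega) (by omega) (fastNat_mono (by omega) (by omega) (by omega)
          le_rfl)
    _ ≤ fastNat 5 y := fastNat_fastNat_le (by omega) (by omega) (by omega)

theorem subF_FChar_le {c b y : ℕ} (hy : 20 ≤ y) (hc : c ≤ y) (hb : b ≤ y) :
    subF (FChar c) c b ≤ fastNat 6 y := by
  have hlt := self_lt_fastNat 4 y
  calc subF (FChar c) c b ≤ fastNat 5 (fastNat 4 y) :=
        FChar_le (by omega) (by omega) (pB_le_fastNat_four hy hc hb)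
    _ ≤ fastNat 5 (fastNat 5 y) :=
        fastNat_mono le_rfl (by omega) (by omega) (fastNat_mono (by omega) (by omega) (by omega)
          le_rfl)
    _ ≤ fastNat 6 y := fastNat_fastNat_le (by omega) (by omega) (by omega)

/-! ### The multiset descent -/

theorem mB_zero (D : ℕ → ℕ) (i : ℕ) : mB D 0 i = 0 := by
  rw [mB, dif_pos rfl]

theorem mB_of_isLeast (D : ℕ → ℕ) {τ : Multiset ℕ} {k : ℕ} (hk : IsLeast {a | a ∈ τ} k) (i : ℕ) :
    mB D τ i = 1 + mB D (replaceOne D τ k i) (i + 1) := by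
  have h0 : τ ≠ 0 := by
    rintro rfl
    exact Multiset.notMem_zero _ hk.1
  rw [mB, dif_neg h0, hk.csInf_eq]

theorem mB_singleton (D : ℕ → ℕ) (k i : ℕ) :
    mB D {k} i = 1 + mB D (Multiset.replicate (k * (D i - 1)) (k - 1)) (i + 1) := by
  rw [mB_of_isLeast D (k := k) ⟨by simp, by intro a; simp +contextual⟩, replaceOne]
  simp

/-- The least element is always replaced, by smaller ones, so `τ` is exhausted before `σ` is
touched. This turns the descent into nested loops. -/
theorem mB_add (D : ℕ → ℕ) (σ : Multiset ℕ) (τ : Multiset ℕ) : ∀ (i : ℕ),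
    (∀ a ∈ τ, ∀ b ∈ σ, a ≤ b) → mB D (τ + σ) i = mB D τ i + mB D σ (i + mB D τ i) := by
  refine (Multiset.wellFounded_isDershowitzMannaLT (α := ℕ)).induction
    (C := fun τ => ∀ (i : ℕ), (∀ a ∈ τ, ∀ b ∈ σ, a ≤ b) →
      mB D (τ + σ) i = mB D τ i + mB D σ (i + mB D τ i)) τ ?_
  intro τ ih i h
  by_cases hτ : τ = 0
  · subst hτ; simp [mB_zero]
  · have hk := min_mem hτ
    have hmin : ∀ a ∈ τ, sInf {k | k ∈ τ} ≤ a := fun a ha => Nat.sInf_le ha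
    set k := sInf {k | k ∈ τ}
    rw [mB_of_isLeast D (τ := τ) ⟨hk, hmin⟩, mB_of_isLeast D (τ := τ + σ) (k := k)]
    · have hrep : replaceOne D (τ + σ) k i = replaceOne D τ k i + σ := by
        rw [replaceOne, replaceOne, Multiset.erase_add_left_pos _ hk]
        abel
      rw [hrep, ih _ (replaceOne_lt D hk i)]
      · rw [add_assoc i, add_assoc 1]
      · intro a ha b hb
        rcases Multiset.mem_add.1 ha with ha | ha
        · exact h a (Multiset.mem_of_mem_erase ha) b hb
        · rw [(Multiset.mem_replicate.1 ha).2]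
          exact (Nat.sub_le _ _).trans (h k hk b hb)
    · refine ⟨Multiset.mem_add.2 (Or.inl hk), fun a ha => ?_⟩
      rcases Multiset.mem_add.1 ha with ha | ha
      · exact hmin a ha
      · exact h k hk a ha

theorem mB_replicate (D : ℕ → ℕ) (k N i : ℕ) :
    i + mB D (Multiset.replicate N k) i = (fun t => t + mB D {k} t)^[N] i := by
  induction N generalizing i with
  | zero => simp [mB_zero]
  | succ N ih =>
    rw [Multiset.replicate_succ, ← Multiset.singleton_add, mB_add, Function.iterate_succ_apply,
      ← ih, add_assoc]
    intro a ha b hb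
    rw [Multiset.mem_singleton.1 ha, (Multiset.mem_replicate.1 hb).2]

/-- The bound concerns the value of the iterate after the descent, not the number of steps. Passing
from `k` to `k + 1` costs one level for the loop over copies of `k` and one for the initial
application of `g`. -/
theorem iterate_mB_singleton_le {g : ℕ → ℕ} {c x : ℕ}
    (hg : ∀ y b, 20 ≤ y → c ≤ y → b ≤ y → g b ≤ fastNat 6 y) (k : ℕ) :
    ∀ y i, 20 ≤ y → c ≤ y → 2 * k + 8 < y → g^[i] x ≤ y →
      g^[i + mB (fun i => g^[i] x + 1) {k} i] x ≤ fastNat (2 * k + 8) y := by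
  induction k with
  | zero =>
    intro y i hy hc hk hi
    rw [mB_singleton]
    simp only [zero_mul, Multiset.replicate_zero, mB_zero, add_zero, Function.iterate_succ_apply']
    exact (hg y _ hy hc hi).trans (fastNat_mono (by omega) (by omega) (by omega) le_rfl)
  | succ k ih =>
    intro y i hy hc hk hi
    set D : ℕ → ℕ := fun i => g^[i] x + 1
    set z := fastNat 6 y
    have hz : y < z := self_lt_fastNat 6 y
    -- This is the number of copies of `k` that replace `k + 1`, since `D i - 1 = g^[i] x`.
    have hN : (k + 1) * g^[i] x ≤ z := by
      have h1 : (k + 1) * g^[i] x ≤ y * y := Nat.mul_le_mul (by omega) hi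
      have h2 : y * y ≤ fastNat 2 y :=
        (Nat.mul_le_mul Nat.lt_two_pow_self.le (Nat.le_succ y)).trans (le_fastNat_two (by omega))
      exact h1.trans (h2.trans (fastNat_mono (by omega) (by omega) (by omega) le_rfl))
    have hiter : ∀ N i' w, z ≤ w → g^[i'] x ≤ w →
        g^[(fun t => t + mB D {k} t)^[N] i'] x ≤ (fastNat (2 * k + 8))^[N] w := by
      intro N
      induction N with
      | zero => intro i' w _ h; exact h
      | succ N ihN =>
        intro i' w hw h
        rw [Function.iterate_succ_apply, Function.iterate_succ_apply]
        exact ihN _ _ (hw.trans (self_lt_fastNat _ w).le)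
          (ih w i' (by omega) (by omega) (by omega) h)
    have hstep : g^[i + 1] x ≤ z := by
      rw [Function.iterate_succ_apply']
      exact hg y _ hy hc hi
    rw [mB_singleton, ← add_assoc, mB_replicate]
    refine (hiter _ _ z le_rfl hstep).trans ?_
    calc (fastNat (2 * k + 8))^[(k + 1) * (D i - 1)] z ≤ fastNat (2 * k + 9) z :=
          fastNat_iterate_le (by omega) (by omega) (by omega) hN
      _ ≤ fastNat (2 * k + 9) (fastNat (2 * k + 9) y) :=
          fastNat_mono le_rfl (by omega) (by omega)
            (fastNat_mono (by omega) (by omega) (by omega) le_rfl)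
      _ ≤ fastNat (2 * (k + 1) + 8) y := fastNat_fastNat_le (by omega) (by omega) (by omega)

/-! ### Levels `ω` and `ω + 1` -/

/-- The notation of `ω`. -/
def omegaNote : NONote := NONote.oadd (NONote.ofNat 1) 1 0 (below_zero _)

/-- The notation of `ω + 1`. -/
def omegaSuccNote : NONote :=
  NONote.oadd (NONote.ofNat 1) 1 (NONote.ofNat 1) (by
    change ONote.NFBelow _ (NONote.ofNat 1).repr
    rw [repr_nonote_ofNat, Nat.cast_one]
    exact ONote.nfBelow_ofNat 1)

theorem repr_omegaNote : omegaNote.repr = ω := by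
  change ONote.repr (ONote.oadd (ONote.ofNat 1) 1 0) = ω
  simp

theorem repr_omegaSuccNote : omegaSuccNote.repr = ω + 1 := by
  change ONote.repr (ONote.oadd (ONote.ofNat 1) 1 (ONote.ofNat 1)) = ω + 1
  simp

theorem coeffNorm_omegaNote : coeffNorm omegaNote.1 = 1 := rfl

theorem coeffNorm_omegaSuccNote : coeffNorm omegaSuccNote.1 = 1 := rfl

theorem ofNat_lt_omegaNote (k : ℕ) : NONote.ofNat k < omegaNote := by
  change (NONote.ofNat k).repr < omegaNote.repr
  rw [repr_nonote_ofNat, repr_omegaNote]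
  exact Ordinal.natCast_lt_omega0 k

theorem omegaNote_lt_succ : omegaNote < omegaSuccNote := by
  change omegaNote.repr < omegaSuccNote.repr
  rw [repr_omegaNote, repr_omegaSuccNote]
  exact Order.lt_add_one_iff.2 le_rfl

theorem fastNat_le_fast_omega {k x y : ℕ} (hk : k < x) (hx : 1 < x) (hxy : x ≤ y) :
    fastNat k x ≤ fast omegaNote y :=
  fast_mono (ofNat_lt_omegaNote k).le (by rwa [coeffNorm_nonote_ofNat]) hx hxy

/-- The first application of level `ω` lifts the argument above `2c + 8`, the second bounds the
descent, and the third covers the extra `+ 1` in `𝔪*`. -/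
theorem uB_FChar_le {c y : ℕ} (hy : 20 ≤ y) (hc : c ≤ y) :
    uB (FChar c) c ≤ (fast omegaNote)^[3] y := by
  set z := fast omegaNote y
  have hz : 4 * y ≤ z := by
    have h1 : 2 ^ 2 * y ≤ (fastNat 1)^[2] y := le_fastNat_one_iterate 2 (by omega)
    exact h1.trans (fast_iterate_le_fast' (ofNat_lt_omegaNote 1)
      (by rw [coeffNorm_nonote_ofNat]; omega) (by omega) (by omega))
  have h1 := iterate_mB_singleton_le (g := subF (FChar c) c) (c := c) (x := c)
    (fun y b hy hc hb => subF_FChar_le hy hc hb) c z 0 (by omega) (by omega) (by omega)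
    (by rw [Function.iterate_zero, id]; omega)
  rw [zero_add] at h1
  have h2 : fastNat (2 * c + 8) z ≤ fast omegaNote z :=
    fastNat_le_fast_omega (by omega) (by omega) le_rfl
  have hlt := self_lt_fast omegaNote z
  rw [uB, mStar, Function.iterate_succ_apply']
  exact (subF_FChar_le (by omega) (by omega) (h1.trans h2)).trans
    (fastNat_le_fast_omega (by omega) (by omega) le_rfl)

/-- One step of `D^char` is bounded by `𝒢^(ω^(ω+1))`. -/
theorem DChar_succ_le {n m b i y : ℕ} (hy : 20 ≤ y) (hn : n ≤ y) (hm : m ≤ y)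
    (hi : DChar n m b i ≤ y) : DChar n m b (i + 1) ≤ fast omegaSuccNote y := by
  rw [DChar]
  set c := DChar n m b i
  -- Three applications bound `𝔲`, a fourth bounds `𝔲⁺`, and a fifth bounds `𝔣`, which is elementary
  -- in `𝔲⁺` and `c`.
  have hmain : (fast omegaNote)^[5] y ≤ fast omegaSuccNote y :=
    fast_iterate_le_fast' omegaNote_lt_succ (by rw [coeffNorm_omegaNote]; omega) (by omega)
      (by omega)
  have hthree : ∀ z, 20 ≤ z → fastNat 3 z ≤ fast omegaNote z := fun z hz =>
    fastNat_le_fast_omega (by omega) (by omega) le_rfl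
  have hu := uB_FChar_le hy hi
  set z := (fast omegaNote)^[3] y with hzdef
  have hyz : y ≤ z := self_le_fast_iterate _ _ _
  have hz1 : 1 < z := by omega
  have hcz : ElemBound z 0 c := ElemBound.of_le (hi.trans hyz)
  have e5 : (fast omegaNote)^[5] y = fast omegaNote (fast omegaNote z) := by
    rw [hzdef]; rfl
  have hz' := self_lt_fast omegaNote z
  have hz'' := self_lt_fast omegaNote (fast omegaNote z)
  refine le_trans ?_ hmain
  rw [e5]
  refine max_le ?_ (max_le ?_ ?_)
  · refine le_trans ?_ hz''.le
    refine le_trans ?_ (hthree z (by omega))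
    have h2c := ElemBound.mul hz1 (ElemBound.of_le hz1) hcz
    have h1 := ElemBound.choose hz1 ((ElemBound.add hz1 h2c
      (ElemBound.of_le (hm.trans hyz))).anti (Nat.sub_le _ 1)) (m - 1)
    have h3 := ElemBound.mul hz1 (ElemBound.mul hz1 h1 (ElemBound.of_le (hn.trans hyz)))
      ((ElemBound.add hz1 hcz (ElemBound.of_le hz1.le)).mono (by omega))
    exact ElemBound.le_fastNat_three (ElemBound.gB hz1 (hcz.mono (by omega)) h3)
      (by omega) (by omega)
  · exact (pB_le_fastNat_four (by omega) (by omega) hu).trans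
      ((fastNat_le_fast_omega (by omega) hz1 le_rfl).trans hz''.le)
  · have hup : uPlus (FChar c) c ≤ fast omegaNote z := by
      refine max_le (hu.trans hz'.le) (le_trans ?_ (hthree z (by omega)))
      have h2c := ElemBound.mul hz1 (ElemBound.of_le hz1) hcz
      have h1 := ElemBound.choose hz1 h2c c
      have h3 := ElemBound.mul hz1 (h2c.mono (by omega)) h1
      exact ElemBound.le_fastNat_three (ElemBound.dB hz1
        ((ElemBound.add hz1 hcz (ElemBound.of_le hz1.le)).mono (by omega))
        (ElemBound.add hz1 h3 (ElemBound.of_le hz1.le))) (by omega) (by omega)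
    refine le_trans ?_ (hthree (fast omegaNote z) (by omega))
    set w := fast omegaNote z
    have hw1 : 1 < w := by omega
    have hU : ElemBound w 0 (uPlus (FChar c) c) := ElemBound.of_le hup
    have hc' : ElemBound w 0 c := ElemBound.of_le (by omega)
    have hN := ElemBound.add hw1 (ElemBound.dB hw1 hU hU) (hU.mono (by omega))
    have h4 := ElemBound.mul hw1 (ElemBound.choose hw1 (ElemBound.add hw1 hN
      (hc'.mono (by omega))) c) (hU.mono (by omega))
    exact ElemBound.le_fastNat_three (ElemBound.add hw1
      (ElemBound.dB hw1 (hU.mono (by omega)) h4) (hN.mono (by omega))) (by omega) (by omega)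

variable {m n : ℕ}

/-! ### Notations for ordinals below `ω ^ ω` -/

/-- The notation of `ω ^ (k - 1) * c (k - 1) + ⋯ + ω * c 1 + c 0`. -/
def polyONote (c : ℕ → ℕ) : ℕ → ONote
  | 0 => 0
  | k + 1 => addTerm (ONote.ofNat k) (c k) (polyONote c k)

theorem polyONote_nfBelow (c : ℕ → ℕ) (k : ℕ) : ONote.NFBelow (polyONote c k) k := by
  induction k with
  | zero => exact ONote.NFBelow.zero
  | succ k ih =>
    refine addTerm_nfBelow inferInstance ?_ ?_ _
    · rwa [ONote.repr_ofNat]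
    · rw [ONote.repr_ofNat]; exact_mod_cast Nat.lt_succ_self k

def polyNote (c : ℕ → ℕ) (k : ℕ) : NONote := ⟨polyONote c k, ⟨⟨_, polyONote_nfBelow c k⟩⟩⟩

theorem repr_addTerm (e : ONote) (k : ℕ) (t : ONote) :
    (addTerm e k t).repr = ω ^ e.repr * k + t.repr := by
  cases k with
  | zero => simp [addTerm]
  | succ k => simp [addTerm, ONote.repr]

theorem repr_polyNote_succ (c : ℕ → ℕ) (k : ℕ) :
    (polyNote c (k + 1)).repr = ω ^ (k : Ordinal.{0}) * c k + (polyNote c k).repr := by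
  change (addTerm _ _ _).repr = _
  rw [repr_addTerm, ONote.repr_ofNat]
  rfl

theorem repr_polyNote_lt (c : ℕ → ℕ) (k : ℕ) : (polyNote c k).repr < ω ^ (k : Ordinal.{0}) :=
  (polyONote_nfBelow c k).repr_lt

theorem repr_polyNote_succ_lt (c : ℕ → ℕ) (k : ℕ) {d : ℕ} (h : c k < d) :
    (polyNote c (k + 1)).repr < ω ^ (k : Ordinal.{0}) * d := by
  rw [repr_polyNote_succ]
  calc ω ^ (k : Ordinal.{0}) * c k + (polyNote c k).repr
      < ω ^ (k : Ordinal.{0}) * c k + ω ^ (k : Ordinal.{0}) := by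
        gcongr; exact repr_polyNote_lt c k
    _ = ω ^ (k : Ordinal.{0}) * ((c k + 1 : ℕ) : Ordinal.{0}) := by push_cast; rw [mul_add_one]
    _ ≤ _ := by gcongr; exact h

theorem le_repr_polyNote (c : ℕ → ℕ) (M : ℕ) :
    ω * (c 1 : Ordinal.{0}) + (c 0 : Ordinal.{0}) ≤ (polyNote c (M + 2)).repr := by
  induction M with
  | zero =>
    rw [repr_polyNote_succ, repr_polyNote_succ]
    simp only [Nat.cast_one, Ordinal.opow_one, Nat.cast_zero, Ordinal.opow_zero, one_mul]
    gcongr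
    exact le_self_add
  | succ M ih =>
    rw [repr_polyNote_succ]
    exact ih.trans le_add_self

theorem polyNote_lt {c d : ℕ → ℕ} {j M : ℕ} (hj : j < M) (h : ∀ i, j < i → c i = d i)
    (hlt : c j < d j) : polyNote c M < polyNote d M := by
  induction M with
  | zero => omega
  | succ M ih =>
    change (polyNote c (M + 1)).repr < (polyNote d (M + 1)).repr
    rcases (Nat.lt_succ_iff.1 hj).lt_or_eq with h' | rfl
    · rw [repr_polyNote_succ, repr_polyNote_succ, h M h']
      gcongr
      exact ih h'
    · refine (repr_polyNote_succ_lt c j hlt).trans_le ?_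
      rw [repr_polyNote_succ]
      exact le_self_add

theorem coeffNorm_polyNote_lt {c : ℕ → ℕ} {k x : ℕ} (hk : k < x) (hc : ∀ i, c i < x) :
    coeffNorm (polyNote c k).1 < x := by
  induction k with
  | zero => exact hk
  | succ k ih =>
    have h1 := coeffNorm_addTerm_le (ONote.ofNat k) (c k) (polyONote c k)
    rw [coeffNorm_ofNat] at h1
    have h2 : coeffNorm (polyONote c k) < x := ih (by omega)
    have h3 := hc k
    refine h1.trans_lt ?_
    omega

/-! ### Covering the extensions of a bad leader sequence by cylinders -/

/-- The derivatives of the indeterminate `var` whose exponents outside `free` are prescribed. -/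
structure Cylinder (m n : ℕ) where
  var : Fin n
  free : Finset (Fin m)
  fixed : Fin m → ℕ

namespace Cylinder

def Mem (v : Derivative m n) (C : Cylinder m n) : Prop :=
  v.var = C.var ∧ ∀ i ∉ C.free, v.exp i = C.fixed i

def dim (C : Cylinder m n) : ℕ := C.free.card

theorem dim_lt (C : Cylinder m n) : C.dim < m + 1 :=
  Nat.lt_succ_of_le ((Finset.card_le_univ _).trans_eq (Fintype.card_fin m))

/-- Cylinders of smaller dimension that cover the elements of `C` that are no derivatives of `u`. -/
def split (C : Cylinder m n) (u : Derivative m n) : Multiset (Cylinder m n) :=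
  C.free.val.bind fun i => (Multiset.range (u.exp i)).map fun a =>
    ⟨C.var, C.free.erase i, Function.update C.fixed i a⟩

theorem dim_lt_of_mem_split {C C' : Cylinder m n} {u : Derivative m n} (h : C' ∈ C.split u) :
    C'.dim < C.dim := by
  obtain ⟨i, hi, h⟩ := Multiset.mem_bind.1 h
  obtain ⟨a, -, rfl⟩ := Multiset.mem_map.1 h
  exact Finset.card_erase_lt_of_mem hi

theorem card_split_le (C : Cylinder m n) (u : Derivative m n) : (C.split u).card ≤ u.order := by
  rw [split, Multiset.card_bind]
  simp only [Function.comp_def, Multiset.card_map, Multiset.card_range]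
  exact Finset.sum_le_sum_of_subset (Finset.subset_univ C.free)

/-- If `v` is no derivative of `u`, some exponent of `v` is smaller than that of `u`. That
coordinate is free, since the others agree, and fixing it leaves finitely many values. -/
theorem exists_mem_split {C : Cylinder m n} {u v : Derivative m n} (hu : Mem u C) (hv : Mem v C)
    (h : ¬ ∃ θ : Fin m → ℕ, u.apply θ = v) : ∃ C' ∈ C.split u, Mem v C' := by
  have hlt : ∃ i, v.exp i < u.exp i := by
    by_contra hcon
    push Not at hcon
    refine h ⟨v.exp - u.exp, Derivative.ext ?_ (hu.1.trans hv.1.symm)⟩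
    exact tsub_add_cancel_of_le hcon
  obtain ⟨i, hi⟩ := hlt
  have hfree : i ∈ C.free := by
    by_contra hcon
    rw [hu.2 i hcon, hv.2 i hcon] at hi
    exact lt_irrefl _ hi
  refine ⟨⟨C.var, C.free.erase i, Function.update C.fixed i (v.exp i)⟩,
    Multiset.mem_bind.2 ⟨i, hfree, Multiset.mem_map.2 ⟨_, Multiset.mem_range.2 hi, rfl⟩⟩,
    hv.1, fun j hj => ?_⟩
  by_cases hji : j = i
  · subst hji; simp
  · change v.exp j = Function.update C.fixed i (v.exp i) j
    rw [Function.update_of_ne hji]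
    exact hv.2 j fun hj' => hj (Finset.mem_erase.2 ⟨hji, hj'⟩)

end Cylinder

/-- The cylinders in `L` contain all derivatives that extend `γ` to a bad leader sequence. -/
def Covers (L : Multiset (Cylinder m n)) (γ : List (Derivative m n)) : Prop :=
  ∀ v, IsBad (v :: γ) → ∃ C ∈ L, Cylinder.Mem v C

/-- The number of cylinders of dimension `k`. -/
def dimCount (L : Multiset (Cylinder m n)) (k : ℕ) : ℕ := L.countP fun C => C.dim = k

/-- Only a cylinder containing `u` is split, and `j` is its dimension; the counts decrease
lexicographically with explicit control on their growth. -/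
theorem Covers.cons {L : Multiset (Cylinder m n)} {γ : List (Derivative m n)}
    {u : Derivative m n} (hL : Covers L γ) (hu : IsBad (u :: γ)) :
    ∃ (L' : Multiset (Cylinder m n)) (j : ℕ), j < m + 1 ∧ Covers L' (u :: γ) ∧
      (∀ i, j < i → dimCount L' i = dimCount L i) ∧ dimCount L' j < dimCount L j ∧
      ∀ i, dimCount L' i ≤ dimCount L i + u.order := by
  classical
  obtain ⟨C, hC, huC⟩ := hL u hu
  obtain ⟨L₀, rfl⟩ := Multiset.exists_cons_of_mem hC
  have hzero : ∀ i, C.dim ≤ i → dimCount (C.split u) i = 0 := by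
    intro i hi
    refine Multiset.countP_eq_zero.2 fun C' hC' h => ?_
    have := Cylinder.dim_lt_of_mem_split hC'
    omega
  have hadd : ∀ i, dimCount (L₀ + C.split u) i = dimCount L₀ i + dimCount (C.split u) i :=
    fun i => Multiset.countP_add _ _ _
  have hcons : ∀ i, dimCount (C ::ₘ L₀) i = dimCount L₀ i + if C.dim = i then 1 else 0 :=
    fun i => Multiset.countP_cons _ _ _
  refine ⟨L₀ + C.split u, C.dim, C.dim_lt, ?_, ?_, ?_, ?_⟩
  · intro v hv
    have h1 := List.pairwise_cons.1 hv
    have hvγ : IsBad (v :: γ) := List.Pairwise.sublist (List.sublist_cons_self u γ |>.cons_cons v) hv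
    obtain ⟨C', hC', hvC'⟩ := hL v hvγ
    rcases Multiset.mem_cons.1 hC' with rfl | hC'
    · obtain ⟨C'', h2, h3⟩ := Cylinder.exists_mem_split huC hvC' (h1.1 u List.mem_cons_self).2
      exact ⟨C'', Multiset.mem_add.2 (Or.inr h2), h3⟩
    · exact ⟨C', Multiset.mem_add.2 (Or.inl hC'), hvC'⟩
  · intro i hi
    rw [hadd, hcons, hzero i hi.le, if_neg hi.ne]
  · rw [hadd, hcons, hzero _ le_rfl, if_pos rfl]
    omega
  · intro i
    have h1 : dimCount (C.split u) i ≤ u.order :=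
      (Multiset.countP_le_card _ _).trans (C.card_split_le u)
    rw [hadd, hcons]
    omega

/-- With a derivation available, every order below that of `u` contributes a lower derivative. -/
theorem Derivative.order_lt_index (hm : 1 ≤ m) (u : Derivative m n) : u.order < u.index := by
  refine Nat.lt_succ_of_le ?_
  let i₀ : Fin m := ⟨0, hm⟩
  let f : ℕ → Derivative m n := fun k => ⟨Pi.single i₀ k, u.var⟩
  have hf : Function.Injective f := by
    intro a b h
    exact Pi.single_injective i₀ (congrArg Derivative.exp h)
  have hsub : f '' (Finset.range u.order : Set ℕ) ⊆ {w : Derivative m n | w.Lower u} := by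
    rintro _ ⟨k, hk, rfl⟩
    refine Or.inl ?_
    have : (f k).order = k := by simp [Derivative.order, f]
    rw [this]
    simpa using hk
  have h := Set.ncard_le_ncard hsub u.finite_lower
  rwa [Set.ncard_image_of_injective _ hf, Set.ncard_coe_finset, Finset.card_range] at h

/-! ### The bound for the tree of bad leader sequences -/

/-- The coefficients of the exponent assigned to a cover with the given dimension counts. -/
def rankCoeff (c : ℕ → ℕ) : ℕ → ℕ
  | 0 => 3 * c 0 + 3
  | 1 => c 1 + 1
  | k + 2 => c (k + 2)

theorem rankCoeff_le (c : ℕ → ℕ) (k : ℕ) : rankCoeff c k ≤ 3 * c k + 3 := by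
  rcases k with _ | _ | k <;> simp only [rankCoeff, zero_add, Nat.add_assoc, Nat.reduceAdd] at * <;> omega

theorem le_rankCoeff (c : ℕ → ℕ) (k : ℕ) : c k ≤ rankCoeff c k := by
  rcases k with _ | _ | k <;> simp only [rankCoeff, zero_add, Nat.add_assoc, Nat.reduceAdd] at * <;> omega

theorem rankCoeff_congr {c d : ℕ → ℕ} {k : ℕ} (h : c k = d k) : rankCoeff c k = rankCoeff d k := by
  rcases k with _ | _ | k <;> simp only [rankCoeff, zero_add, Nat.add_assoc, Nat.reduceAdd] at * <;> omega

/-- For `k = 0`, the factor 3 gives `3 * c 0 + 3 ≤ 3 * d 0`, which leaves room for the intermediate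
levels of `hB_le`. -/
theorem rankCoeff_lt_update {c d : ℕ → ℕ} {k : ℕ} (h : c k < d k) :
    rankCoeff c k < Function.update (rankCoeff d) 0 (3 * d 0 + 1) k := by
  rcases k with _ | _ | k <;> simp [rankCoeff] <;> omega

/-- The quantity followed through the loop is `D` at the accumulator, so `D` need not be monotone.
-/
theorem foldr_le {D : ℕ → ℕ} {f : ℕ → ℕ → ℕ} {e : NONote} {y : ℕ} {l : List ℕ}
    (hf : ∀ u ∈ l, ∀ w z, y ≤ z → D w ≤ z → D (f u w) ≤ fast e z) {w : ℕ} (hw : D w ≤ y) :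
    D (l.foldr f w) ≤ (fast e)^[l.length] y := by
  induction l with
  | nil => exact hw
  | cons u l ih =>
    rw [List.foldr_cons, List.length_cons, Function.iterate_succ_apply']
    exact hf u List.mem_cons_self _ _ (self_le_fast_iterate _ _ _)
      (ih fun u hu => hf u (List.mem_cons_of_mem _ hu))

theorem iterate_add_le {D h : ℕ → ℕ} {e : NONote} {y : ℕ}
    (hh : ∀ t z, y ≤ z → D t ≤ z → D (t + h t) ≤ fast e z) (k : ℕ) {w z : ℕ} (hz : y ≤ z)
    (hw : D w ≤ z) : D ((fun t => t + h t)^[k] w) ≤ (fast e)^[k] z := by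
  induction k with
  | zero => exact hw
  | succ k ih =>
    rw [Function.iterate_succ_apply', Function.iterate_succ_apply']
    exact hh _ _ (hz.trans (self_le_fast_iterate _ _ _)) ih

/-- If one step of `D` is bounded by `𝒢^(ω^(ω+1))`, then `𝔥(D, γ)` steps are bounded by the level
that a cover of the extensions of `γ` determines. -/
theorem hB_le {K : ℕ} (hK : 20 ≤ K) (hm : 1 ≤ m) (hmK : m + 1 < K) (γ : BadSeq m n) :
    ∀ (D : ℕ → ℕ) (L : Multiset (Cylinder m n)) (y : ℕ),
      (∀ i z, K ≤ z → D i ≤ z → D (i + 1) ≤ fast omegaSuccNote z) → Covers L γ.1 → K ≤ y →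
      (∀ k, rankCoeff (dimCount L) k < y) → D 0 ≤ y →
      D (hB D γ) ≤ fast (polyNote (rankCoeff (dimCount L)) (m + 1)) y := by
  induction γ using BadSeq.extends_wf.induction with
  | h γ ih =>
  intro D L y hD hL hy hcoeff h0
  set a := rankCoeff (dimCount L) with ha
  have ha0 : a 0 = 3 * dimCount L 0 + 3 := rfl
  -- `e₁` absorbs the inner loop over `k`, `e₂` the outer loop over `u`, and the full rank the
  -- composition with the preliminary enlargement of `y`.
  set e₁ := polyNote (Function.update a 0 (3 * dimCount L 0 + 1)) (m + 1) with he₁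
  set e₂ := polyNote (Function.update a 0 (3 * dimCount L 0 + 2)) (m + 1) with he₂
  have hnorm : ∀ v, v ≤ a 0 → coeffNorm (polyNote (Function.update a 0 v) (m + 1)).1 < y := by
    intro v hv
    refine coeffNorm_polyNote_lt (by omega) fun k => ?_
    by_cases hk : k = 0
    · subst hk
      rw [Function.update_self]
      exact hv.trans_lt (hcoeff 0)
    · rw [Function.update_of_ne hk]
      exact hcoeff k
  have h12 : e₁ < e₂ := by
    refine polyNote_lt (j := 0) (by omega) (fun i hi => ?_) (by simp)
    rw [Function.update_of_ne hi.ne', Function.update_of_ne hi.ne']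
  have h23 : e₂ < polyNote a (m + 1) := by
    refine polyNote_lt (j := 0) (by omega) (fun i hi => ?_) (by simp [ha0])
    rw [Function.update_of_ne hi.ne']
  -- The summand `1` in the coefficient of `ω` makes `e₂ ≥ ω + 2`, even for an empty cover.
  have hW : omegaSuccNote < e₂ := by
    change omegaSuccNote.repr < e₂.repr
    obtain ⟨M, rfl⟩ : ∃ M, m = M + 1 := ⟨m - 1, by omega⟩
    rw [repr_omegaSuccNote]
    refine lt_of_lt_of_le ?_ (le_repr_polyNote _ M)
    rw [Function.update_self, Function.update_of_ne one_ne_zero]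
    refine lt_of_lt_of_le (b := ω + 2) ?_ (add_le_add (le_mul_of_one_le_right' ?_) ?_)
    · gcongr; exact one_lt_two
    · exact_mod_cast Nat.succ_le_succ (Nat.zero_le _)
    · exact_mod_cast Nat.le_add_left 2 _
  set y₁ := fast omegaSuccNote y with hy₁
  set y₂ := fast omegaSuccNote y₁ with hy₂
  have hyy₁ : y < y₁ := self_lt_fast _ _
  -- The new coefficients are at most `3 * (dimCount L k + v.order) + 3`, with both summands below
  -- `y₁`, so `8 * y₁` exceeds them.
  have hy₂' : 8 * y₁ ≤ y₂ := by
    have h1 : 2 ^ 3 * y₁ ≤ (fastNat 1)^[3] y₁ := le_fastNat_one_iterate 3 (by omega)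
    exact h1.trans (fast_iterate_le_fast' ((ofNat_lt_omegaNote 1).trans omegaNote_lt_succ)
      (by rw [coeffNorm_nonote_ofNat]; omega) (by omega) (by omega))
  have hD1 : D 1 ≤ y₁ := hD 0 y hy h0
  have hfinal : (fast e₁)^[D 1 + 1] y₂ ≤ fast (polyNote a (m + 1)) y := by
    calc (fast e₁)^[D 1 + 1] y₂ ≤ fast e₂ y₂ :=
          fast_iterate_le_fast' h12 ((hnorm _ (by omega)).trans (by omega)) (by omega) (by omega)
      _ ≤ fast e₂ (fast e₂ y) := by
          refine fast_mono le_rfl ((hnorm _ (by omega)).trans (by omega)) (by omega) ?_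
          exact fast_iterate_le_fast' (j := 2) hW (by rw [coeffNorm_omegaSuccNote]; omega)
            (by omega) (by omega)
      _ ≤ fast (polyNote a (m + 1)) y :=
          fast_iterate_le_fast' (j := 2) h23 (hnorm _ (by omega)) (by omega) (by omega)
  refine le_trans ?_ hfinal
  rw [hB]
  have hlen : (List.range (D 1 + 1)).length = D 1 + 1 := List.length_range
  conv_rhs => rw [← hlen]
  refine foldr_le (y := y₂) ?_ (by omega)
  intro u hu w z hz hwz
  have hu' : u < D 1 + 1 := List.mem_range.1 hu
  split_ifs with hex
  · set v := hex.choose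
    have hvu : v.index = u := hex.choose_spec.1
    have hord := Derivative.order_lt_index hm v
    obtain ⟨L', j, hj, hcov, heq, hlt, hle⟩ := hL.cons hex.choose_spec.2
    have hcoeff' : ∀ k, rankCoeff (dimCount L') k < y₂ := by
      intro k
      have h1 := rankCoeff_le (dimCount L') k
      have h2 := hle k
      have h3 := le_rankCoeff (dimCount L) k
      have h4 := hcoeff k
      change _ ≤ _ + v.order at h2
      rw [← ha] at h3
      omega
    have hlt' : polyNote (rankCoeff (dimCount L')) (m + 1) < e₁ := by
      refine polyNote_lt hj (fun i hi => ?_) (rankCoeff_lt_update hlt)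
      rw [Function.update_of_ne (by omega)]
      exact rankCoeff_congr (heq i hi)
    -- The inner loop has `D w ≤ z` rounds, so its length is absorbed by `fast e₁ z`.
    refine (iterate_add_le (y := y₂) (e := polyNote (rankCoeff (dimCount L')) (m + 1)) ?_ (D w)
      hz hwz).trans
      (fast_iterate_le_fast' hlt' (coeffNorm_polyNote_lt (by omega) fun k =>
        (hcoeff' k).trans_le hz) (by omega) hwz)
    intro t z hz ht
    exact ih ⟨v :: γ.1, hex.choose_spec.2⟩ ⟨v, rfl⟩ (fun i => D (t + i)) L' z
      (fun i z hz hi => hD (t + i) z hz hi) hcov (by omega)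
      (fun k => (hcoeff' k).trans_le hz) ht
  · exact hwz.trans (self_lt_fast e₁ z).le

/-- The cylinders that cover all derivatives. -/
def fullCover (m n : ℕ) : Multiset (Cylinder m n) :=
  (Finset.univ : Finset (Fin n)).val.map fun r => ⟨r, Finset.univ, fun _ => 0⟩

theorem covers_fullCover (γ : List (Derivative m n)) : Covers (fullCover m n) γ := fun v _ =>
  ⟨⟨v.var, Finset.univ, fun _ => 0⟩, Multiset.mem_map.2 ⟨v.var, Finset.mem_univ_val _, rfl⟩,
    rfl, fun i hi => absurd (Finset.mem_univ i) hi⟩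

theorem dimCount_fullCover (k : ℕ) : dimCount (fullCover m n) k = if k = m then n else 0 := by
  rw [dimCount, fullCover, Multiset.countP_map]
  simp only [Cylinder.dim, Finset.card_univ, Fintype.card_fin, eq_comm (a := m)]
  split_ifs with h <;> simp [h]

theorem hB_nil_of_isEmpty (D : ℕ → ℕ) (m : ℕ) : hB D (BadSeq.nil m 0) = 1 := by
  have hfold : ∀ l : List ℕ, l.foldr (fun _ w => w) 1 = 1 := by
    intro l
    induction l with
    | nil => rfl
    | cons a l ih => exact ih
  rw [hB]
  convert hfold (List.range (D 1 + 1)) using 2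
  funext u w
  rw [dif_neg]
  rintro ⟨v, -⟩
  exact v.var.elim0

/-- For `m ≥ 2` the leading coefficient is `n < 2n`, which absorbs the corrections. For `m = 1` it
is `n + 1`, and the final `+ ω` is needed when `n = 1`. -/
theorem repr_polyNote_fullCover_lt (hm : 1 ≤ m) (hn : 1 ≤ n) :
    (polyNote (rankCoeff (dimCount (fullCover m n))) (m + 1)).repr <
      ω ^ (m : Ordinal.{0}) * ((2 * n : ℕ) : Ordinal.{0}) + ω := by
  obtain rfl | hm' := hm.eq_or_lt
  · have h : rankCoeff (dimCount (fullCover 1 n)) 1 < n + 2 := by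
      simp [rankCoeff, dimCount_fullCover]
    refine (repr_polyNote_succ_lt _ 1 h).trans_le ?_
    have h2 : ω ^ ((1 : ℕ) : Ordinal.{0}) * ((2 * n : ℕ) : Ordinal.{0}) + ω =
        ω ^ ((1 : ℕ) : Ordinal.{0}) * ((2 * n + 1 : ℕ) : Ordinal.{0}) := by
      rw [Nat.cast_one, Ordinal.opow_one, Nat.cast_succ, mul_add_one]
    rw [h2]
    exact mul_le_mul_right (by exact_mod_cast (by omega : n + 2 ≤ 2 * n + 1)) _
  · obtain ⟨k, rfl⟩ : ∃ k, m = k + 2 := ⟨m - 2, by omega⟩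
    have h : rankCoeff (dimCount (fullCover (k + 2) n)) (k + 2) < 2 * n := by
      simp only [rankCoeff, dimCount_fullCover, if_true]
      omega
    exact (repr_polyNote_succ_lt _ (k + 2) h).trans_le le_self_add

theorem iChar_le_fast {b y : ℕ} (hm : 1 ≤ m) (hy : 30 ≤ y) (hym : 3 * m + 3 < y)
    (hyn : 3 * n + 3 < y) (hyb : b ≤ y) :
    iChar n m b ≤ fast (polyNote (rankCoeff (dimCount (fullCover m n))) (m + 1)) y := by
  refine hB_le (K := max (max 20 n) (m + 2)) (by omega) hm (by omega) (BadSeq.nil m n)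
    (DChar n m b) (fullCover m n) y (fun i z hz hi => ?_) (covers_fullCover _) (by omega)
    (fun k => ?_) hyb
  · exact DChar_succ_le (by omega) (by omega) (by omega) hi
  · refine (rankCoeff_le _ k).trans_lt ?_
    rw [dimCount_fullCover]
    split_ifs <;> omega

theorem iChar_zero_le_fast {b y : ℕ} (hy : 20 ≤ y) (hym : m ≤ y) (hyb : b ≤ y) :
    iChar 0 m b ≤ fast omegaSuccNote y := by
  rw [iChar, hB_nil_of_isEmpty]
  exact DChar_succ_le hy (Nat.zero_le _) hym hyb

/-! ### The ordinal of the theorem -/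

theorem exists_prepend_term {e t : NONote} (k : ℕ) (h : NONote.below t e) :
    ∃ o : NONote, o.repr = ω ^ e.repr * ((k + 1 : ℕ) : Ordinal.{0}) + t.repr ∧
      (∀ x, iterNote G o x = (fast e)^[k + 1] (iterNote G t x)) ∧
      ∀ e', e < e' → NONote.below o e' :=
  ⟨NONote.oadd e k.succPNat t h, rfl, iterNote_oadd_fast e k t h,
    fun _ he => ONote.NF.below_of_lt he (NONote.oadd e k.succPNat t h).2⟩

/-- The part of the ordinal of the theorem that does not depend on `m` and `n`. -/
theorem exists_base_note : ∃ o t : NONote,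
    o.repr = ω ^ (ω + 1 : Ordinal.{0}) * 5 + ω ^ (ω : Ordinal.{0}) * 2
      + ω ^ (2 : Ordinal.{0}) * 5 + ω * 10 ∧
    (∀ x, iterNote G o x = (fast omegaSuccNote)^[5] (iterNote G t x)) ∧
    (∀ x, 1 ≤ x → 512 * (x + 1) ≤ iterNote G t x) ∧
    ∀ e, omegaSuccNote < e → NONote.below o e := by
  obtain ⟨o₁, hr₁, hi₁, hb₁⟩ := exists_prepend_term 9 (below_zero (NONote.ofNat 1))
  obtain ⟨o₂, hr₂, hi₂, hb₂⟩ := exists_prepend_term 4 (hb₁ _ (nonote_ofNat_lt one_lt_two))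
  obtain ⟨o₃, hr₃, hi₃, hb₃⟩ := exists_prepend_term 1 (hb₂ _ (ofNat_lt_omegaNote 2))
  obtain ⟨o₄, hr₄, hi₄, hb₄⟩ := exists_prepend_term 4 (hb₃ _ omegaNote_lt_succ)
  refine ⟨o₄, o₃, ?_, hi₄, fun x hx => ?_, hb₄⟩
  · have h0 : (0 : NONote).repr = 0 := rfl
    rw [hr₄, hr₃, hr₂, hr₁, repr_omegaNote, repr_omegaSuccNote, repr_nonote_ofNat,
      repr_nonote_ofNat, h0, add_zero, Nat.cast_one, Ordinal.opow_one]
    norm_num [add_assoc]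
  · rw [hi₃, hi₂, hi₁, iterNote_of_eq G 0 rfl]
    refine le_trans ?_ ((self_le_fast_iterate _ _ _).trans (self_le_fast_iterate _ _ _))
    change _ ≤ (fastNat 1)^[9 + 1] x
    -- Doubling requires an argument above `1`: one of the ten applications secures this, and nine
    -- give the factor `2 ^ 9 = 512`.
    rw [Function.iterate_succ_apply]
    have h1 := self_lt_fastNat 1 x
    have h2 := le_fastNat_one_iterate 9 (x := fastNat 1 x) (by omega)
    omega

theorem exists_repr_eq (m k : ℕ) : ∃ e₁ e₂ : NONote,
    e₁.repr = ω ^ (m : Ordinal.{0}) * (k : Ordinal.{0}) + ω ∧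
    e₂.repr = ω ^ (m : Ordinal.{0}) * (k : Ordinal.{0}) + 5 := by
  refine ⟨NONote.opow omegaNote (NONote.ofNat m) * NONote.ofNat k + omegaNote,
    NONote.opow omegaNote (NONote.ofNat m) * NONote.ofNat k + NONote.ofNat 5, ?_, ?_⟩ <;>
  simp [NONote.repr_add, NONote.repr_mul, NONote.repr_opow, repr_omegaNote, repr_nonote_ofNat]

end CharBound

end

open CharBound in
theorem mainTheorem11 (n m b : ℕ) (hm : 1 ≤ m) (hb : max m n ≤ b) :
    CharBound.iChar n m b ≤
      CharBound.ordIter CharBound.G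
        (ω ^ (ω ^ (m : Ordinal.{0}) * ((2 * n : ℕ) : Ordinal.{0}) + ω)
          + ω ^ (ω ^ (m : Ordinal.{0}) * ((2 * n : ℕ) : Ordinal.{0}) + 5)
          + ω ^ (ω + 1 : Ordinal.{0}) * 5
          + ω ^ (ω : Ordinal.{0}) * 2
          + ω ^ (2 : Ordinal.{0}) * 5
          + ω * 10) b := by
  have hb1 : 1 ≤ b := by omega
  obtain ⟨o, t, hr, hi, hx, hbel⟩ := exists_base_note
  have hy := hx b hb1
  -- For `n = 0` the given sum is not in normal form: its first two terms are absorbed by `ω ^ (ω +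
  -- 1) * 5`. As there are no derivatives, `𝔥 = 1` and one step of `D^char` suffices.
  rcases Nat.eq_zero_or_pos n with rfl | hn
  · have hα : (ω ^ (ω ^ (m : Ordinal.{0}) * ((2 * 0 : ℕ) : Ordinal.{0}) + ω)
          + ω ^ (ω ^ (m : Ordinal.{0}) * ((2 * 0 : ℕ) : Ordinal.{0}) + 5)
          + ω ^ (ω + 1 : Ordinal.{0}) * 5
          + ω ^ (ω : Ordinal.{0}) * 2
          + ω ^ (2 : Ordinal.{0}) * 5
          + ω * 10) = o.repr := by
      have habs : ω ^ (ω : Ordinal.{0}) + ω ^ (5 : Ordinal.{0}) + ω ^ (ω + 1 : Ordinal.{0}) * 5 =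
          ω ^ (ω + 1 : Ordinal.{0}) * 5 := by
        refine Ordinal.add_of_omega0_opow_le (b := ω + 1) ?_ ?_
        · refine Ordinal.isPrincipal_add_omega0_opow _ ?_ ?_
          · exact (Ordinal.opow_lt_opow_iff_right Ordinal.one_lt_omega0).2
              (Order.lt_add_one_iff.2 le_rfl)
          · refine (Ordinal.opow_lt_opow_iff_right Ordinal.one_lt_omega0).2 (lt_of_lt_of_le ?_ le_self_add)
            exact_mod_cast Ordinal.natCast_lt_omega0 5
        · exact le_mul_of_one_le_right' (by exact_mod_cast (by omega : 1 ≤ 5))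
      rw [hr, mul_zero, Nat.cast_zero, mul_zero, zero_add, zero_add, habs]
    rw [hα, ordIter_repr, hi, Function.iterate_succ_apply]
    exact (iChar_zero_le_fast (by omega) (by omega) (by omega)).trans (self_le_fast_iterate _ _ _)
  · obtain ⟨e₁, e₂, h₁, h₂⟩ := exists_repr_eq m (2 * n)
    -- This puts both large exponents above `ω + 1`, so for `n ≥ 1` the sum is a Cantor normal form.
    have hω : ω * 2 ≤ ω ^ (m : Ordinal.{0}) * ((2 * n : ℕ) : Ordinal.{0}) := by
      refine mul_le_mul' ?_ ?_
      · calc ω = ω ^ (1 : Ordinal.{0}) := (Ordinal.opow_one ω).symm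
          _ ≤ _ := Ordinal.opow_le_opow_right Ordinal.omega0_pos (by exact_mod_cast hm)
      · exact_mod_cast (by omega : 2 ≤ 2 * n)
    have hlt₂ : omegaSuccNote.repr < e₂.repr := by
      rw [repr_omegaSuccNote, h₂]
      calc ω + 1 < ω + ω := by gcongr; exact Ordinal.one_lt_omega0
        _ = ω * 2 := by rw [← one_add_one_eq_two, mul_add_one, mul_one]
        _ ≤ _ := hω.trans le_self_add
    have hlt₁ : e₂.repr < e₁.repr := by
      rw [h₁, h₂]
      gcongr
      exact_mod_cast Ordinal.natCast_lt_omega0 5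
    obtain ⟨o₂, hr₂, hi₂, hb₂⟩ := exists_prepend_term 0 (hbel e₂ hlt₂)
    obtain ⟨o₁, hr₁, hi₁, -⟩ := exists_prepend_term 0 (hb₂ e₁ hlt₁)
    have hα : (ω ^ (ω ^ (m : Ordinal.{0}) * ((2 * n : ℕ) : Ordinal.{0}) + ω)
          + ω ^ (ω ^ (m : Ordinal.{0}) * ((2 * n : ℕ) : Ordinal.{0}) + 5)
          + ω ^ (ω + 1 : Ordinal.{0}) * 5
          + ω ^ (ω : Ordinal.{0}) * 2
          + ω ^ (2 : Ordinal.{0}) * 5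
          + ω * 10) = o₁.repr := by
      rw [hr₁, hr₂, hr, h₁, h₂]
      simp [← add_assoc]
    rw [hα, ordIter_repr, hi₁, hi₂]
    -- Only `fast e₁` carries the estimate; `fast e₂` and the lower terms merely enlarge the
    -- argument.
    change _ ≤ fast e₁ (fast e₂ (iterNote G o b))
    set y := iterNote G o b with hydef
    have hty : iterNote G t b ≤ y := by
      rw [hydef, hi]
      exact self_le_fast_iterate _ _ _
    have hy' := self_lt_fast e₂ y
    refine (iChar_le_fast hm (y := y) (by omega) (by omega) (by omega) (by omega)).trans ?_
    refine fast_mono ?_ (coeffNorm_polyNote_lt (by omega) fun k => ?_) (by omega) hy'.le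
    · change NONote.repr _ ≤ e₁.repr
      rw [h₁]
      exact (repr_polyNote_fullCover_lt hm hn).le
    · refine (rankCoeff_le _ k).trans_lt ?_
      rw [dimCount_fullCover]
      split_ifs <;> omega
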